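/- **Theorem (topological zero-one law for filtrations).** Let $(\Omega,P)$ be a standard Borel space with a nonatomic probability measure (for example $(0,1)$ with Lebesgue measure). Let $G$ be the group of invertible measure preserving maps $\Omega\to\Omega$, two maps being identified when they agree almost everywhere (equivalently, the group of measure preserving automorphisms of the measure algebra), with the topology of pointwise convergence on the measure algebra: $g_n\to g$ iff $P(g_nA\,\triangle\,gA)\to 0$ for every measurable $A$. A sub-$\sigma$-field is a $\sigma$-field consisting of measurable sets and containing all measurable sets of measure zero. The set of all sub-$\sigma$-fields carries the Wijsman topology of the closed subspaces $L_2(\mathcal E)\subset L_2(\Omega,P)$, that is, the topology of pointwise convergence of the functions $f\mapsto\min\bigl(1,\operatorname{dist}(f,L_2(\mathcal E))\bigr)$ on $L_2(\Omega,P)$; and $g\in G$ acts by $g\cdot\mathcal E=\{gA : A\in\mathcal E\}$. Let $X_1$ be the space of those sub-$\sigma$-fields $\mathcal E$ that are conditionally nonatomic, i.e. almost all conditional measures of $P$ given $\mathcal E$ are nonatomic. Let $T\subset[0,+\infty]$ be compact, and let $X_T\subset C(T,X_1)$ be the set of all continuous maps $t\mapsto\mathcal F_t$ from $T$ to $X_1$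 such that $\mathcal F_s\subset\mathcal F_t$ whenever $s\le t$, and such that $\mathcal F_t$ consists of sets of probability $0$ or $1$ only when $t$ is the least element of $T$. The space $C(T,X_1)$ carries the topology of uniform convergence, $X_T$ the subspace topology, and $G$ acts on $X_T$ by $g\cdot(\mathcal F_t)_{t\in T}=(g\cdot\mathcal F_t)_{t\in T}$. Then the space $X_T$ is ergodic, that is: $X_T$ is a Polish $G$-space ($G$ is a Polish group, $X_T$ is a Polish space, and the action $G\times X_T\to X_T$ is continuous), and every $G$-invariant set $A\subset X_T$ with the Baire property is meager or comeager in $X_T$. -/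

import Mathlib

open MeasureTheory ProbabilityTheory Set Filter
open scoped ENNReal

/-! ### Polish `G`-spaces and ergodicity -/

/-- `X` is a Polish `G`-space: `G` is a Polish group acting continuously on the Polish space `X`. -/
structure IsPolishGSpace (G X : Type*) [Group G] [TopologicalSpace G] [TopologicalSpace X]
    [MulAction G X] : Prop where
  isTopologicalGroup : IsTopologicalGroup G
  polishGroup : PolishSpace G
  polishSpace : PolishSpace X
  continuousSMul : ContinuousSMul G X

/-- A Polish `G`-space is ergodic if every `G`-invariant set with the Baire property is
meager or comeager. -/
structure IsErgodicGSpace (G X : Type*) [Group G] [TopologicalSpace G] [TopologicalSpace X]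
    [MulAction G X] : Prop where
  isPolishGSpace : IsPolishGSpace G X
  meager_or_comeager : ∀ A : Set X, (∀ g : G, ∀ x ∈ A, g • x ∈ A) → BaireMeasurableSet A →
    IsMeagre A ∨ A ∈ residual X

/-! ### The Wijsman topology -/

/-- The Wijsman topology on the closed subsets of a metric space: the topology of pointwise
convergence of the distance functions `x ↦ min 1 (dist (x, F))`, where `dist (x, ∅) = ∞`. -/
noncomputable abbrev wijsmanTopology (X : Type*) [MetricSpace X] :
    TopologicalSpace (TopologicalSpace.Closeds X) :=
  TopologicalSpace.induced (fun F x => min 1 (Metric.infEDist x (F : Set X)))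
    (inferInstance : TopologicalSpace (X → ℝ≥0∞))

namespace ProbSpace

/-! ### The automorphism group of a probability space -/

section Aut

variable {Ω : Type*} [MeasurableSpace Ω] (P : Measure Ω)

/-- The group of invertible measure preserving maps `Ω → Ω` (not yet identified mod 0). -/
def mpPerm : Subgroup (Equiv.Perm Ω) where
  carrier := {e | MeasurePreserving e P P ∧ MeasurePreserving e.symm P P}
  one_mem' := ⟨MeasurePreserving.id P, MeasurePreserving.id P⟩
  mul_mem' ha hb := ⟨ha.1.comp hb.1, hb.2.comp ha.2⟩
  inv_mem' ha := ⟨ha.2, ha.1⟩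

/-- The invertible measure preserving maps that are equal to the identity almost everywhere. -/
def nullPerm : Subgroup (mpPerm P) where
  carrier := {e | ∀ᵐ ω ∂P, (e : Equiv.Perm Ω) ω = ω}
  one_mem' := by
    show ∀ᵐ ω ∂P, (1 : Equiv.Perm Ω) ω = ω
    simp
  mul_mem' {a b} ha hb := by
    have hb' : ∀ᵐ ω ∂P, (b : Equiv.Perm Ω) ω = ω := hb
    have ha' : ∀ᵐ ω ∂P, (a : Equiv.Perm Ω) ω = ω := ha
    show ∀ᵐ ω ∂P, (a : Equiv.Perm Ω) ((b : Equiv.Perm Ω) ω) = ω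
    filter_upwards [ha', hb'] with ω h1 h2
    rw [h2, h1]
  inv_mem' {a} ha := by
    have ha' : ∀ᵐ ω ∂P, (a : Equiv.Perm Ω) ω = ω := ha
    show ∀ᵐ ω ∂P, (a : Equiv.Perm Ω).symm ω = ω
    filter_upwards [ha'] with ω h
    rw [Equiv.symm_apply_eq, h]

instance nullPerm_normal : (nullPerm P).Normal where
  conj_mem n hn g := by
    have hn' : ∀ᵐ ω ∂P, (n : Equiv.Perm Ω) ω = ω := hn
    show ∀ᵐ ω ∂P,
      (g : Equiv.Perm Ω) ((n : Equiv.Perm Ω) ((g : Equiv.Perm Ω).symm ω)) = ω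
    filter_upwards [g.2.2.quasiMeasurePreserving.ae hn'] with ω h
    rw [h, Equiv.apply_symm_apply]

/-- The image of a measurable set under an invertible measure preserving map. -/
def imageSet (e : mpPerm P) (s : MeasuredSets P) : MeasuredSets P :=
  ⟨(e : Equiv.Perm Ω) '' s.1, by
    rw [Equiv.image_eq_preimage_symm]
    exact e.2.2.measurable s.2⟩

/-- The topology of pointwise convergence on the measure algebra: `e n → e` iff
`P (e n '' s ∆ e '' s) → 0` for every measurable set `s`. -/
noncomputable instance mpPermTopology : TopologicalSpace (mpPerm P) :=
  TopologicalSpace.induced (fun e s => imageSet P e s)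
    (inferInstance : TopologicalSpace (MeasuredSets P → MeasuredSets P))

/-- The group `Aut (Ω, P)` of (equivalence classes mod 0 of) measure preserving automorphisms. On a
nonatomic standard Borel probability space this is the group of all measure preserving
automorphisms of the measure algebra of `P`, since each of these is induced by an invertible
measure preserving map `Ω → Ω`. The topology is the quotient topology, which is the topology of
pointwise convergence on the measure algebra. -/
abbrev Aut : Type _ := mpPerm P ⧸ nullPerm P

end Aut

/-! ### Sub-σ-fields -/

section SubSigmaField

variable {Ω : Type*} [mΩ : MeasurableSpace Ω] (P : Measure Ω)

/-- A sub-σ-field (containing all sets of measure zero). -/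
structure SubSigmaField where
  toMeasurableSpace : MeasurableSpace Ω
  le : toMeasurableSpace ≤ mΩ
  measurableSet_of_null : ∀ s, MeasurableSet[mΩ] s → P s = 0 → MeasurableSet[toMeasurableSpace] s

variable {P}

namespace SubSigmaField

lemma ext : ∀ {E F : SubSigmaField P}, E.toMeasurableSpace = F.toMeasurableSpace → E = F
  | ⟨_, _, _⟩, ⟨_, _, _⟩, rfl => rfl

/-- A sub-σ-field `E` as the closed subspace `L₂(E)` of `L₂(Ω, P)`. -/
noncomputable def toClosedSubspace (E : SubSigmaField P) :
    TopologicalSpace.Closeds (Lp ℝ 2 P) where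
  carrier := (lpMeas ℝ ℝ E.toMeasurableSpace 2 P : Set (Lp ℝ 2 P))
  isClosed' := isClosed_aestronglyMeasurable E.le

/-- The Wijsman topology on sub-σ-fields, these being treated as subspaces of `L₂(Ω, P)`. -/
noncomputable instance : TopologicalSpace (SubSigmaField P) :=
  TopologicalSpace.induced toClosedSubspace (wijsmanTopology (Lp ℝ 2 P))

/-- The image of a sub-σ-field under an invertible measure preserving map: a set belongs to it iff
its preimage belongs to the given sub-σ-field. -/
def image (e : mpPerm P) (E : SubSigmaField P) : SubSigmaField P where
  toMeasurableSpace := E.toMeasurableSpace.map (e : Equiv.Perm Ω)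
  le := fun s hs => by
    have h := e.2.2.measurable (E.le _ hs)
    rwa [← preimage_comp, Equiv.self_comp_symm, preimage_id] at h
  measurableSet_of_null := fun s hs h0 =>
    E.measurableSet_of_null _ (e.2.1.measurable hs) (by
      rw [e.2.1.measure_preimage hs.nullMeasurableSet, h0])

instance : MulAction (mpPerm P) (SubSigmaField P) where
  smul := image
  one_smul _ := rfl
  mul_smul _ _ _ := rfl

lemma measurableSet_smul {e : mpPerm P} {E : SubSigmaField P} {s : Set Ω} :
    MeasurableSet[(e • E).toMeasurableSpace] s ↔
      MeasurableSet[E.toMeasurableSpace] ((e : Equiv.Perm Ω) ⁻¹' s) := Iff.rfl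

/-- Sub-σ-fields do not distinguish sets that are equal mod 0. -/
lemma measurableSet_congr (E : SubSigmaField P) {s t : Set Ω} (hs : MeasurableSet s)
    (ht : MeasurableSet t) (h : s =ᵐ[P] t) (hE : MeasurableSet[E.toMeasurableSpace] s) :
    MeasurableSet[E.toMeasurableSpace] t := by
  have h1 : MeasurableSet[E.toMeasurableSpace] (s \ t) :=
    E.measurableSet_of_null _ (hs.diff ht) (ae_le_set.1 h.le)
  have h2 : MeasurableSet[E.toMeasurableSpace] (t \ s) :=
    E.measurableSet_of_null _ (ht.diff hs) (ae_le_set.1 h.symm.le)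
  have h3 : t = (s \ (s \ t)) ∪ (t \ s) := by
    ext x
    simp only [mem_union, Set.mem_sdiff]
    tauto
  rw [h3]
  exact (hE.diff h1).union h2

lemma smul_eq_of_mem_nullPerm {e : mpPerm P} (he : e ∈ nullPerm P) (E : SubSigmaField P) :
    e • E = E := by
  have he' : ∀ᵐ ω ∂P, (e : Equiv.Perm Ω) ω = ω := he
  have key : ∀ s : Set Ω, ((e : Equiv.Perm Ω) ⁻¹' s : Set Ω) =ᵐ[P] s := fun s => by
    filter_upwards [he'] with ω h
    show ((e : Equiv.Perm Ω) ω ∈ s) = (ω ∈ s)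
    rw [h]
  refine SubSigmaField.ext (MeasurableSpace.ext fun s => ⟨fun h => ?_, fun h => ?_⟩)
  · exact E.measurableSet_congr (E.le _ (measurableSet_smul.1 h)) ((e • E).le _ h) (key s)
      (measurableSet_smul.1 h)
  · exact measurableSet_smul.2 (E.measurableSet_congr (E.le _ h)
      (e.2.1.measurable (E.le _ h)) (key s).symm h)

/-- The action `Aut (Ω, P) → Perm (SubSigmaField P)`: the class of `e` sends `E` to `e • E`. -/
def autHom (P : Measure Ω) : Aut P →* Equiv.Perm (SubSigmaField P) :=
  QuotientGroup.lift (nullPerm P) (MulAction.toPermHom (mpPerm P) (SubSigmaField P))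
    (fun _ he => Equiv.ext fun E => smul_eq_of_mem_nullPerm he E)

instance : MulAction (Aut P) (SubSigmaField P) := MulAction.compHom _ (autHom P)

lemma mk_smul (e : mpPerm P) (E : SubSigmaField P) :
    (QuotientGroup.mk e : Aut P) • E = e • E := rfl

/-- The isometry `f ↦ f ∘ e` of `L₂(Ω, P)` sends `L₂(e • E)` onto `L₂(E)`. -/
lemma image_toClosedSubspace_smul (e : mpPerm P) (E : SubSigmaField P) :
    Lp.compMeasurePreserving (e : Equiv.Perm Ω) e.2.1 ''
      ((e • E).toClosedSubspace : Set (Lp ℝ 2 P)) = E.toClosedSubspace := by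
  have h1 : Measurable[E.toMeasurableSpace, (e • E).toMeasurableSpace] (e : Equiv.Perm Ω) :=
    fun s hs => measurableSet_smul.1 hs
  have h2 : Measurable[(e • E).toMeasurableSpace, E.toMeasurableSpace]
      (e : Equiv.Perm Ω).symm := fun s hs => measurableSet_smul.2 (by
    rwa [← preimage_comp, Equiv.symm_comp_self, preimage_id])
  apply Subset.antisymm
  · rintro _ ⟨g, ⟨g', hg', hgg'⟩, rfl⟩
    refine ⟨g' ∘ (e : Equiv.Perm Ω), hg'.comp_measurable h1, ?_⟩
    exact (Lp.coeFn_compMeasurePreserving g e.2.1).trans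
      (e.2.1.quasiMeasurePreserving.ae_eq_comp hgg')
  · rintro f ⟨f', hf', hff'⟩
    refine ⟨Lp.compMeasurePreserving (e : Equiv.Perm Ω).symm e.2.2 f,
      ⟨f' ∘ (e : Equiv.Perm Ω).symm, hf'.comp_measurable h2, ?_⟩, ?_⟩
    · exact (Lp.coeFn_compMeasurePreserving f e.2.2).trans
        (e.2.2.quasiMeasurePreserving.ae_eq_comp hff')
    · apply Lp.ext
      refine (Lp.coeFn_compMeasurePreserving _ e.2.1).trans ?_
      refine (e.2.1.quasiMeasurePreserving.ae_eq_comp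
        (Lp.coeFn_compMeasurePreserving f e.2.2)).trans ?_
      rw [Function.comp_assoc, Equiv.symm_comp_self, Function.comp_id]

lemma continuous_smul_const (e : mpPerm P) :
    Continuous fun E : SubSigmaField P => e • E := by
  rw [continuous_induced_rng, continuous_induced_rng, continuous_pi_iff]
  intro f
  have h : ∀ E : SubSigmaField P,
      min 1 (Metric.infEDist f ((e • E).toClosedSubspace : Set (Lp ℝ 2 P))) =
      min 1 (Metric.infEDist (Lp.compMeasurePreserving (e : Equiv.Perm Ω) e.2.1 f)
        (E.toClosedSubspace : Set (Lp ℝ 2 P))) := fun E => by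
    rw [← image_toClosedSubspace_smul e E,
      Metric.infEDist_image (Lp.isometry_compMeasurePreserving e.2.1)]
  have h1 : Continuous fun (F : SubSigmaField P) (x : Lp ℝ 2 P) =>
      min 1 (Metric.infEDist x (F.toClosedSubspace : Set (Lp ℝ 2 P))) :=
    continuous_iff_le_induced.2 (by
      rw [show (fun (F : SubSigmaField P) (x : Lp ℝ 2 P) =>
          min 1 (Metric.infEDist x (F.toClosedSubspace : Set (Lp ℝ 2 P)))) =
        (fun (F : TopologicalSpace.Closeds (Lp ℝ 2 P)) (x : Lp ℝ 2 P) =>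
          min 1 (Metric.infEDist x (F : Set (Lp ℝ 2 P)))) ∘ toClosedSubspace from rfl,
        ← induced_compose]
      exact le_rfl)
  simp only [Function.comp_def, h]
  exact (continuous_pi_iff.1 h1) (Lp.compMeasurePreserving (e : Equiv.Perm Ω) e.2.1 f)

/-- `E` is trivial if it consists of sets of probability `0` or `1` only. -/
def IsTrivial (E : SubSigmaField P) : Prop :=
  ∀ s, MeasurableSet[E.toMeasurableSpace] s → P s = 0 ∨ P s = 1

lemma IsTrivial.smul {E : SubSigmaField P} (h : E.IsTrivial) (e : mpPerm P) :
    (e • E).IsTrivial := fun s hs => by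
  have := h _ (measurableSet_smul.1 hs)
  rwa [e.2.1.measure_preimage ((e • E).le _ hs).nullMeasurableSet] at this

/-- `E` is conditionally nonatomic if almost all conditional measures given `E` are nonatomic. -/
def IsCondNonatomic [StandardBorelSpace Ω] [IsFiniteMeasure P] (E : SubSigmaField P) : Prop :=
  ∀ᵐ ω ∂P, NullSingletonClass (condExpKernel P E.toMeasurableSpace ω)

/-- Transport of conditional probabilities. -/
lemma condExp_smul_comp [IsFiniteMeasure P] (e : mpPerm P) (E : SubSigmaField P) {s : Set Ω}
    (hs : MeasurableSet s) :
    P⟦s | (e • E).toMeasurableSpace⟧ ∘ (e : Equiv.Perm Ω) =ᵐ[P]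
      P⟦(e : Equiv.Perm Ω) ⁻¹' s | E.toMeasurableSpace⟧ := by
  have h1 : Measurable[E.toMeasurableSpace, (e • E).toMeasurableSpace] (e : Equiv.Perm Ω) :=
    fun s hs => measurableSet_smul.1 hs
  have hemb : MeasurableEmbedding (e : Equiv.Perm Ω) :=
    MeasurableEquiv.measurableEmbedding
      ⟨(e : Equiv.Perm Ω), e.2.1.measurable, e.2.2.measurable⟩
  have hint : Integrable (P⟦s | (e • E).toMeasurableSpace⟧ ∘ (e : Equiv.Perm Ω)) P :=
    (e.2.1.integrable_comp_emb hemb).2 integrable_condExp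
  refine ae_eq_condExp_of_forall_setIntegral_eq E.le
    ((integrable_const (1 : ℝ)).indicator (e.2.1.measurable hs))
    (fun _ _ _ => hint.integrableOn) (fun A hA _ => ?_)
    (stronglyMeasurable_condExp.comp_measurable h1).aestronglyMeasurable
  set B : Set Ω := (e : Equiv.Perm Ω).symm ⁻¹' A with hB
  have hAB : (e : Equiv.Perm Ω) ⁻¹' B = A := by
    rw [hB, ← preimage_comp, Equiv.symm_comp_self, preimage_id]
  have hBm : MeasurableSet[(e • E).toMeasurableSpace] B :=
    measurableSet_smul.2 (by rwa [hAB])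
  rw [← hAB]
  simp only [Function.comp_def]
  rw [e.2.1.setIntegral_preimage_emb hemb
      (fun x => (P⟦s | (e • E).toMeasurableSpace⟧) x),
    setIntegral_condExp (e • E).le ((integrable_const (1 : ℝ)).indicator hs) hBm,
    ← e.2.1.setIntegral_preimage_emb hemb]
  rfl

lemma IsCondNonatomic.smul [StandardBorelSpace Ω] [IsFiniteMeasure P] {E : SubSigmaField P}
    (h : E.IsCondNonatomic) (e : mpPerm P) : (e • E).IsCondNonatomic := by
  have key : ∀ s : Set Ω, MeasurableSet s → ∀ᵐ ω ∂P,
      condExpKernel P (e • E).toMeasurableSpace ((e : Equiv.Perm Ω) ω) s =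
        (condExpKernel P E.toMeasurableSpace ω).map (e : Equiv.Perm Ω) s := fun s hs => by
    filter_upwards [e.2.1.quasiMeasurePreserving.ae
        (condExpKernel_ae_eq_condExp (e • E).le (μ := P) hs),
      condExpKernel_ae_eq_condExp E.le (μ := P) (e.2.1.measurable hs),
      condExp_smul_comp e E hs] with ω h1 h2 h3
    rw [Measure.map_apply e.2.1.measurable hs, ← measureReal_eq_measureReal_iff, h1, h2, ← h3]
    rfl
  set C := generateSetAlgebra (MeasurableSpace.countableGeneratingSet Ω) with hC
  have hCgen : MeasurableSpace.generateFrom C = mΩ := by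
    rw [hC, generateFrom_generateSetAlgebra_eq,
      MeasurableSpace.generateFrom_countableGeneratingSet]
  have hCc : C.Countable :=
    countable_generateSetAlgebra MeasurableSpace.countable_countableGeneratingSet
  have hCpi : IsPiSystem C := fun s hs t ht _ =>
    (isSetAlgebra_generateSetAlgebra).inter_mem hs ht
  have hCm : ∀ s ∈ C, MeasurableSet s := fun s hs => by
    rw [← hCgen]
    exact MeasurableSpace.measurableSet_generateFrom hs
  have hall := (ae_ball_iff hCc).2 fun s hs => key s (hCm s hs)
  have hmain : ∀ᵐ ω ∂P, NullSingletonClass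
      (condExpKernel P (e • E).toMeasurableSpace ((e : Equiv.Perm Ω) ω)) := by
    filter_upwards [hall, h, key univ MeasurableSet.univ] with ω h1 h2 h3
    have heq := ext_of_generate_finite C hCgen.symm hCpi h1 h3
    rw [heq]
    refine ⟨fun x => ?_⟩
    rw [Measure.map_apply e.2.1.measurable (measurableSet_singleton x)]
    refine (measure_mono_null (t := {(e : Equiv.Perm Ω).symm x}) ?_ (measure_singleton _))
    intro y hy
    rw [mem_singleton_iff, Equiv.eq_symm_apply]
    exact hy
  filter_upwards [e.2.2.quasiMeasurePreserving.ae hmain] with ω hω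
  rwa [Equiv.apply_symm_apply] at hω

end SubSigmaField

end SubSigmaField

/-! ### The space of continuous filtrations -/

section Filtrations

variable {Ω : Type*} [mΩ : MeasurableSpace Ω] [StandardBorelSpace Ω]

/-- The space `X₁` of conditionally nonatomic sub-σ-fields. -/
abbrev CondNonatomicField (P : Measure Ω) [IsFiniteMeasure P] : Type _ :=
  {E : SubSigmaField P // E.IsCondNonatomic}

variable {P : Measure Ω} [IsFiniteMeasure P]

instance : MulAction (Aut P) (CondNonatomicField P) where
  smul g E := ⟨g • E.1, QuotientGroup.induction_on g fun e => E.2.smul e⟩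
  one_smul E := Subtype.ext (one_smul (Aut P) E.1)
  mul_smul g h E := Subtype.ext (mul_smul g h E.1)

instance : ContinuousConstSMul (Aut P) (CondNonatomicField P) where
  continuous_const_smul g := QuotientGroup.induction_on g fun e =>
    ((SubSigmaField.continuous_smul_const e).comp continuous_subtype_val).subtype_mk
      fun E => E.2.smul e

/-- A continuous map `x : T → X₁` is a (continuous) filtration starting from the trivial σ-field if
it is increasing, and its value at the least element of `T` is trivial. -/
structure IsFiltration {T : Set ℝ≥0∞} (x : C(T, CondNonatomicField P)) : Prop where
  mono : ∀ s t : T, s ≤ t → (x s).1.toMeasurableSpace ≤ (x t).1.toMeasurableSpace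
  trivial_of_least : ∀ t : T, (∀ s : T, t ≤ s) → (x t).1.IsTrivial

/-- The space `X_T` of continuous filtrations on `T` that start from the trivial σ-field, with the
topology of `C(T, X₁)`. -/
abbrev FiltrationSpace (P : Measure Ω) [IsFiniteMeasure P] (T : Set ℝ≥0∞) : Type _ :=
  {x : C(T, CondNonatomicField P) // IsFiltration x}

/-- `(g • x) t = g • x t`. -/
noncomputable instance (T : Set ℝ≥0∞) : MulAction (Aut P) (FiltrationSpace P T) where
  smul g x := ⟨g • x.1, QuotientGroup.induction_on g fun e =>
    ⟨fun s t hst _ hA => x.2.mono s t hst _ hA,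
      fun t ht => (x.2.trivial_of_least t ht).smul e⟩⟩
  one_smul x := Subtype.ext (one_smul (Aut P) x.1)
  mul_smul g h x := Subtype.ext (mul_smul g h x.1)

end Filtrations

end ProbSpace

/-!
A sub-σ-field is determined by the orthogonal projection onto its `L₂` space, and the Wijsman
topology becomes the strong operator topology of these projections. Both the sub-σ-fields and the
automorphisms, acting by Koopman operators, are thereby closed in a countable power of `L₂`, and
conditional nonatomicity is a `Gδ` condition; so everything is Polish.

For the zero-one law, let `x` and `y` be two filtrations, and write `Ω` as a product of two copies
of itself, with projections `p` and `q`. The filtration `z` that joins the copy of `x` along `p`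
with the copy of `y` along `q` satisfies `dist (f ∘ p, L₂ (z t)) = dist (f, L₂ (x t))`. Since `p`
is a limit of automorphisms, `x` is in the closure of the orbit of `z`, and so is `y`. Thus any two
nonempty open sets are visited by a common orbit, which excludes an invariant set with the Baire
property that is comeagre in one nonempty open set and meagre in another.
-/

open Topology
open scoped symmDiff

namespace ProbSpace

/-! ### Closed subspaces and sublattices of `Lp` -/

section ClosedSublattice

variable {Ω : Type*} {m : MeasurableSpace Ω} [mΩ : MeasurableSpace Ω] {P : Measure Ω}
  [IsFiniteMeasure P] {p : ℝ≥0∞}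

lemma tendsto_Lp_of_ae_tendsto_of_norm_le {E : Type*} [NormedAddCommGroup E] [Fact (1 ≤ p)]
    (hp : p ≠ ∞) {u : ℕ → Lp E p P} {f : Lp E p P} {C : NNReal}
    (hC : ∀ n, ∀ᵐ x ∂P, ‖u n x‖₊ ≤ C) (h : ∀ᵐ x ∂P, Tendsto (fun n => u n x) atTop (𝓝 (f x))) :
    Tendsto u atTop (𝓝 f) := by
  refine (Lp.tendsto_Lp_iff_tendsto_eLpNorm' u f).2 ?_
  have hmeas n : AEStronglyMeasurable (u n) P := Lp.aestronglyMeasurable (u n)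
  refine tendsto_Lp_finite_of_tendsto_ae Fact.out hp hmeas (Lp.memLp f) ?_ h
  refine unifIntegrable_of Fact.out hp hmeas fun ε _ => ⟨C + 1, fun n => ?_⟩
  have hzero : {x | C + 1 ≤ ‖u n x‖₊}.indicator (u n) =ᵐ[P] 0 := by
    filter_upwards [hC n] with x hx
    exact indicator_of_notMem (s := {x | C + 1 ≤ ‖u n x‖₊})
      (fun hle => (lt_add_one C).not_ge (hle.trans hx)) (u n)
  rw [eLpNorm_congr_ae hzero, eLpNorm_zero]
  exact zero_le

/-- The indicator of a measurable set, as an element of `Lp ℝ p P`; the exponent is left to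
unification. -/
noncomputable def indicatorLp (P : Measure Ω) [IsFiniteMeasure P] {s : Set Ω}
    (hs : MeasurableSet s) : Lp ℝ p P :=
  indicatorConstLp p hs (measure_ne_top P s) 1

lemma coeFn_indicatorLp {s : Set Ω} (hs : MeasurableSet s) :
    (indicatorLp P hs : Lp ℝ p P) =ᵐ[P] s.indicator fun _ => (1 : ℝ) :=
  indicatorConstLp_coeFn

lemma coeFn_indicatorLp_univ :
    (indicatorLp P MeasurableSet.univ : Lp ℝ p P) =ᵐ[P] fun _ => (1 : ℝ) := by
  simpa only [indicator_univ] using coeFn_indicatorLp (P := P) (p := p) MeasurableSet.univ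

lemma indicatorLp_congr {s t : Set Ω} (hs : MeasurableSet s) (ht : MeasurableSet t)
    (h : s =ᵐ[P] t) : (indicatorLp P hs : Lp ℝ p P) = indicatorLp P ht :=
  (indicatorConstLp_inj hs _ ht _ one_ne_zero).2 h

lemma indicatorLp_eq_zero {s : Set Ω} (hs : MeasurableSet s) (h : P s = 0) :
    (indicatorLp P hs : Lp ℝ p P) = 0 :=
  (indicatorLp_congr hs .empty (ae_eq_empty.2 h)).trans indicatorConstLp_empty

lemma norm_indicatorLp_sq {s : Set Ω} (hs : MeasurableSet s) :
    ‖(indicatorLp P hs : Lp ℝ 2 P)‖ ^ 2 = P.real s := by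
  rw [indicatorLp, norm_indicatorConstLp (by simp) (by simp), norm_one, one_mul,
    ENNReal.toReal_ofNat, ← Real.rpow_natCast, ← Real.rpow_mul measureReal_nonneg]
  norm_num

lemma indicatorLp_compl {s : Set Ω} (hs : MeasurableSet s) :
    (indicatorLp P hs.compl : Lp ℝ p P) = indicatorLp P MeasurableSet.univ - indicatorLp P hs := by
  ext1
  grw [Lp.coeFn_sub, coeFn_indicatorLp, coeFn_indicatorLp, coeFn_indicatorLp]
  rw [indicator_univ, indicator_compl]

lemma indicatorLp_union {s t : Set Ω} (hs : MeasurableSet s) (ht : MeasurableSet t) :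
    (indicatorLp P (hs.union ht) : Lp ℝ p P) = indicatorLp P hs ⊔ indicatorLp P ht := by
  ext1
  filter_upwards [Lp.coeFn_sup (indicatorLp P hs) (indicatorLp P ht),
    coeFn_indicatorLp (P := P) (p := p) hs, coeFn_indicatorLp (P := P) (p := p) ht,
    coeFn_indicatorLp (P := P) (p := p) (hs.union ht)] with x hsup hxs hxt hunion
  rw [hsup, hunion, Pi.sup_apply, hxs, hxt]
  by_cases hx : x ∈ s <;> by_cases hy : x ∈ t <;> simp [hx, hy]

lemma indicatorConst_eq_smul_indicatorLp (c : ℝ) {s : Set Ω} (hs : MeasurableSet s) :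
    (Lp.simpleFunc.indicatorConst p hs (measure_ne_top P s) c : Lp ℝ p P) =
      c • indicatorLp P hs := by
  rw [Lp.simpleFunc.coe_indicatorConst, indicatorLp, indicatorConstLp,
    indicatorConstLp, ← MemLp.toLp_const_smul]
  congr 1
  ext x
  by_cases hx : x ∈ s <;> simp [hx]

lemma indicatorLp_iUnion_mem_of_monotone [Fact (1 ≤ p)] (hp : p ≠ ∞) {K : Set (Lp ℝ p P)}
    (hK : IsClosed K) {s : ℕ → Set Ω} (hs : ∀ i, MeasurableSet (s i)) (hmono : Monotone s)
    (h : ∀ i, indicatorLp P (hs i) ∈ K) : indicatorLp P (MeasurableSet.iUnion hs) ∈ K := by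
  refine hK.mem_of_tendsto (b := atTop) (f := fun i => indicatorLp P (hs i)) ?_ (.of_forall h)
  refine tendsto_Lp_of_ae_tendsto_of_norm_le hp (C := 1) (fun n => ?_) ?_
  · filter_upwards [coeFn_indicatorLp (P := P) (p := p) (hs n)] with x hx
    rw [hx]
    by_cases hxs : x ∈ s n <;> simp [hxs]
  · filter_upwards [ae_all_iff.2 fun n => coeFn_indicatorLp (P := P) (p := p) (hs n),
      coeFn_indicatorLp (P := P) (p := p) (MeasurableSet.iUnion hs)] with x hx hx'
    simp only [hx, hx']
    exact (hmono.tendsto_indicator s (fun _ => (1 : ℝ)) x).mono_right (pure_le_nhds _)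

section GeneratingPiSystem

variable [Fact (1 ≤ p)] {K : Submodule ℝ (Lp ℝ p P)}

lemma indicatorLp_iUnion_mem_of_disjoint (hp : p ≠ ∞) (hK : IsClosed (K : Set (Lp ℝ p P)))
    {s : ℕ → Set Ω} (hs : ∀ i, MeasurableSet (s i)) (hdisj : Pairwise (Function.onFun Disjoint s))
    (h : ∀ i, indicatorLp P (hs i) ∈ K) : indicatorLp P (MeasurableSet.iUnion hs) ∈ K := by
  have hacc n : MeasurableSet (accumulate s n) := .biUnion (to_countable _) fun i _ => hs i
  rw [indicatorLp_congr (.iUnion hs) (.iUnion hacc) (.of_eq iUnion_accumulate.symm)]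
  refine indicatorLp_iUnion_mem_of_monotone hp hK hacc monotone_accumulate fun n => ?_
  induction n with
  | zero =>
    rw [indicatorLp_congr (hacc 0) (hs 0) (.of_eq (accumulate_zero_nat s))]
    exact h 0
  | succ n ih =>
    rw [indicatorLp_congr (hacc (n + 1)) ((hacc n).union (hs (n + 1)))
      (.of_eq (accumulate_succ s n)), indicatorLp, indicatorConstLp_disjoint_union (hacc n)
      (hs (n + 1)) (measure_ne_top _ _) (measure_ne_top _ _)
      (disjoint_accumulate hdisj n.lt_succ_self)]
    exact K.add_mem ih (h _)

lemma indicatorLp_mem_of_generateFrom (hp : p ≠ ∞) (hK : IsClosed (K : Set (Lp ℝ p P)))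
    (hm : m ≤ mΩ) {C : Set (Set Ω)}
    (hC : m = MeasurableSpace.generateFrom C) (hpi : IsPiSystem C)
    (huniv : indicatorLp P MeasurableSet.univ ∈ K)
    (h : ∀ s ∈ C, ∀ hs : MeasurableSet s, indicatorLp P hs ∈ K) {s : Set Ω}
    (hs : MeasurableSet[m] s) : indicatorLp P (hm s hs) ∈ K := by
  induction s, hs using MeasurableSpace.induction_on_inter hC hpi with
  | empty =>
    rw [indicatorLp_eq_zero _ measure_empty]
    exact K.zero_mem
  | basic s hs => exact h s hs _
  | compl s hs ih =>
    rw [indicatorLp_compl (hm s hs)]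
    exact K.sub_mem huniv ih
  | iUnion s hdisj hs ih =>
    exact indicatorLp_iUnion_mem_of_disjoint hp hK (fun i => hm _ (hs i)) hdisj ih

theorem lpMeas_le_of_generateFrom (hp : p ≠ ∞) (hK : IsClosed (K : Set (Lp ℝ p P)))
    (hm : m ≤ mΩ) {C : Set (Set Ω)}
    (hC : m = MeasurableSpace.generateFrom C) (hpi : IsPiSystem C)
    (huniv : indicatorLp P MeasurableSet.univ ∈ K)
    (h : ∀ s ∈ C, ∀ hs : MeasurableSet s, indicatorLp P hs ∈ K) : lpMeas ℝ ℝ m p P ≤ K := by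
  intro f hf
  refine Lp.induction_stronglyMeasurable hm hp (fun f => f ∈ K) (fun c s hs _ => ?_)
    (fun f g _ _ _ _ _ hfK hgK => K.add_mem hfK hgK) (hK.preimage continuous_subtype_val) f hf
  rw [indicatorConst_eq_smul_indicatorLp c (hm s hs)]
  exact K.smul_mem _ (indicatorLp_mem_of_generateFrom hp hK hm hC hpi huniv h hs)

theorem eq_top_of_generateFrom (hp : p ≠ ∞) (hK : IsClosed (K : Set (Lp ℝ p P)))
    {C : Set (Set Ω)} (hC : mΩ = MeasurableSpace.generateFrom C) (hpi : IsPiSystem C)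
    (huniv : indicatorLp P MeasurableSet.univ ∈ K)
    (h : ∀ s ∈ C, ∀ hs : MeasurableSet s, indicatorLp P hs ∈ K) : K = ⊤ := by
  refine eq_top_iff.2 fun f _ => lpMeas_le_of_generateFrom hp hK le_rfl hC hpi huniv h ?_
  exact mem_lpMeas_iff_aestronglyMeasurable.2 (Lp.aestronglyMeasurable f)

end GeneratingPiSystem

omit [IsFiniteMeasure P] in
lemma measurableSet_lt_coeFn (a : ℝ) (f : Lp ℝ p P) : MeasurableSet {x | a < f x} :=
  measurableSet_lt measurable_const (Lp.stronglyMeasurable f).measurable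

/-- The functions `min (n (f - a)⁺) 1`, which increase to the indicator of `{f > a}`. -/
noncomputable def levelApprox (f : Lp ℝ p P) (a : ℝ) (n : ℕ) : Lp ℝ p P :=
  ((n : ℝ) • ((f - a • indicatorLp P MeasurableSet.univ) ⊔ 0)) ⊓ indicatorLp P MeasurableSet.univ

lemma coeFn_levelApprox (f : Lp ℝ p P) (a : ℝ) (n : ℕ) :
    levelApprox f a n =ᵐ[P] fun x => min (n * max (f x - a) 0) 1 := by
  let one : Lp ℝ p P := indicatorLp P MeasurableSet.univ
  filter_upwards [Lp.coeFn_inf ((n : ℝ) • ((f - a • one) ⊔ 0)) one,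
    Lp.coeFn_smul (n : ℝ) ((f - a • one) ⊔ 0), Lp.coeFn_sup (f - a • one) 0,
    Lp.coeFn_sub f (a • one), Lp.coeFn_smul a one, Lp.coeFn_zero ℝ p P,
    coeFn_indicatorLp_univ (P := P) (p := p)] with x hinf hsmul hsup hsub hsmul' hzero hone
  rw [levelApprox, hinf, Pi.inf_apply, hsmul, Pi.smul_apply, hsup, Pi.sup_apply, hsub,
    Pi.sub_apply, hsmul', Pi.smul_apply, hzero, hone]
  simp

lemma tendsto_min_natCast_mul_one {t : ℝ} (ht : 0 < t) :
    Tendsto (fun n : ℕ => min (n * t) 1) atTop (𝓝 1) := by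
  refine tendsto_const_nhds.congr' ?_
  filter_upwards [(tendsto_natCast_atTop_atTop.atTop_mul_const ht).eventually_ge_atTop 1] with n hn
  exact (min_eq_right hn).symm

lemma tendsto_levelApprox [Fact (1 ≤ p)] (hp : p ≠ ∞) (f : Lp ℝ p P) (a : ℝ) :
    Tendsto (levelApprox f a) atTop (𝓝 (indicatorLp P (measurableSet_lt_coeFn a f))) := by
  refine tendsto_Lp_of_ae_tendsto_of_norm_le hp (C := 1) (fun n => ?_) ?_
  · filter_upwards [coeFn_levelApprox f a n] with x hx
    rw [hx, ← NNReal.coe_le_coe, coe_nnnorm, Real.norm_of_nonneg (by positivity)]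
    exact min_le_right _ _
  · filter_upwards [ae_all_iff.2 (coeFn_levelApprox f a),
      coeFn_indicatorLp (P := P) (p := p) (measurableSet_lt_coeFn a f)] with x hx hind
    simp only [hx, hind]
    by_cases hax : a < f x
    · simpa [hax, max_eq_left (sub_nonneg.2 hax.le)] using
        tendsto_min_natCast_mul_one (sub_pos.2 hax)
    · simp [hax, max_eq_right (sub_nonpos.2 (not_lt.1 hax))]

section Sublattice

variable {K : Submodule ℝ (Lp ℝ p P)}

omit [IsFiniteMeasure P] in
lemma sup_mem_of_abs_mem (habs : ∀ f ∈ K, |f| ∈ K) {f g : Lp ℝ p P} (hf : f ∈ K) (hg : g ∈ K) :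
    f ⊔ g ∈ K := by
  rw [sup_eq_half_smul_add_add_abs_sub' ℝ]
  exact K.smul_mem _ (K.add_mem (K.add_mem hf hg) (habs _ (K.sub_mem hg hf)))

omit [IsFiniteMeasure P] in
lemma inf_mem_of_abs_mem (habs : ∀ f ∈ K, |f| ∈ K) {f g : Lp ℝ p P} (hf : f ∈ K) (hg : g ∈ K) :
    f ⊓ g ∈ K := by
  rw [inf_eq_half_smul_add_sub_abs_sub' ℝ]
  exact K.smul_mem _ (K.sub_mem (K.add_mem hf hg) (habs _ (K.sub_mem hg hf)))

lemma levelApprox_mem (habs : ∀ f ∈ K, |f| ∈ K) (huniv : indicatorLp P MeasurableSet.univ ∈ K)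
    {f : Lp ℝ p P} (hf : f ∈ K) (a : ℝ) (n : ℕ) : levelApprox f a n ∈ K :=
  inf_mem_of_abs_mem habs (K.smul_mem _ (sup_mem_of_abs_mem habs
    (K.sub_mem hf (K.smul_mem _ huniv)) K.zero_mem)) huniv

variable [Fact (1 ≤ p)]

theorem indicatorLp_lt_mem (hp : p ≠ ∞) (hK : IsClosed (K : Set (Lp ℝ p P)))
    (habs : ∀ f ∈ K, |f| ∈ K) (huniv : indicatorLp P MeasurableSet.univ ∈ K) {f : Lp ℝ p P}
    (hf : f ∈ K) (a : ℝ) : indicatorLp P (measurableSet_lt_coeFn a f) ∈ K :=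
  hK.mem_of_tendsto (tendsto_levelApprox hp f a) (.of_forall (levelApprox_mem habs huniv hf a))

lemma indicatorLp_iUnion_mem_of_abs_mem (hp : p ≠ ∞) (hK : IsClosed (K : Set (Lp ℝ p P)))
    (habs : ∀ f ∈ K, |f| ∈ K) {s : ℕ → Set Ω} (hs : ∀ i, MeasurableSet (s i))
    (h : ∀ i, indicatorLp P (hs i) ∈ K) : indicatorLp P (MeasurableSet.iUnion hs) ∈ K := by
  have hacc n : MeasurableSet (accumulate s n) := .biUnion (to_countable _) fun i _ => hs i
  rw [indicatorLp_congr (.iUnion hs) (.iUnion hacc) (.of_eq iUnion_accumulate.symm)]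
  refine indicatorLp_iUnion_mem_of_monotone hp hK hacc monotone_accumulate fun n => ?_
  induction n with
  | zero =>
    rw [indicatorLp_congr (hacc 0) (hs 0) (.of_eq (accumulate_zero_nat s))]
    exact h 0
  | succ n ih =>
    rw [indicatorLp_congr (hacc (n + 1)) ((hacc n).union (hs (n + 1)))
      (.of_eq (accumulate_succ s n)), indicatorLp_union (hacc n) (hs (n + 1))]
    exact sup_mem_of_abs_mem habs ih (h _)

end Sublattice

end ClosedSublattice

/-! ### A coordinate on a standard Borel space -/

section Coord

variable (Ω : Type*) [mΩ : MeasurableSpace Ω] [StandardBorelSpace Ω]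

/-- A measurable embedding of a standard Borel space into the interval `(0, 1)`: a bounded function
that generates the σ-algebra and separates points. -/
noncomputable def coord (ω : Ω) : ℝ := Real.sigmoid (embeddingReal Ω ω)

lemma measurableEmbedding_coord : MeasurableEmbedding (coord Ω) :=
  (continuous_sigmoid.measurableEmbedding Real.sigmoid_injective).comp
    (measurableEmbedding_embeddingReal Ω)

lemma measurable_coord : Measurable (coord Ω) := (measurableEmbedding_coord Ω).measurable

lemma coord_injective : Function.Injective (coord Ω) := (measurableEmbedding_coord Ω).injective

variable {Ω}

lemma coord_pos (ω : Ω) : 0 < coord Ω ω := Real.sigmoid_pos _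

lemma coord_lt_one (ω : Ω) : coord Ω ω < 1 := Real.sigmoid_lt_one _

lemma isPiSystem_setOf_lt_coord : IsPiSystem (range fun a : ℝ => {ω : Ω | a < coord Ω ω}) := by
  rintro _ ⟨a, rfl⟩ _ ⟨b, rfl⟩ _
  exact ⟨max a b, by ext; simp⟩

lemma generateFrom_setOf_lt_coord :
    mΩ = MeasurableSpace.generateFrom (range fun a : ℝ => {ω : Ω | a < coord Ω ω}) := by
  refine (measurableEmbedding_coord Ω).comap_eq.symm.trans ?_
  rw [BorelSpace.measurable_eq (α := ℝ), borel_eq_generateFrom_Ioi,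
    MeasurableSpace.comap_generateFrom, ← range_comp]
  rfl

variable (P : Measure Ω) [IsFiniteMeasure P] {p : ℝ≥0∞}

lemma memLp_coord : MemLp (coord Ω) p P :=
  .of_bound (measurable_coord Ω).aestronglyMeasurable 1 <| .of_forall fun ω => by
    rw [Real.norm_of_nonneg (coord_pos ω).le]
    exact (coord_lt_one ω).le

/-- The coordinate as an element of `Lp ℝ p P`. -/
noncomputable def coordLp : Lp ℝ p P := (memLp_coord P).toLp

lemma coeFn_coordLp : (coordLp P : Lp ℝ p P) =ᵐ[P] coord Ω := MemLp.coeFn_toLp _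

theorem eq_top_of_coordLp_mem [Fact (1 ≤ p)] (hp : p ≠ ∞) {K : Submodule ℝ (Lp ℝ p P)}
    (hK : IsClosed (K : Set (Lp ℝ p P))) (habs : ∀ f ∈ K, |f| ∈ K)
    (huniv : indicatorLp P MeasurableSet.univ ∈ K) (h : coordLp P ∈ K) : K = ⊤ := by
  refine eq_top_of_generateFrom hp hK generateFrom_setOf_lt_coord isPiSystem_setOf_lt_coord huniv ?_
  rintro _ ⟨a, rfl⟩ hs
  rw [indicatorLp_congr hs (measurableSet_lt_coeFn a (coordLp P))]
  · exact indicatorLp_lt_mem hp hK habs huniv h a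
  · filter_upwards [coeFn_coordLp (p := p) P] with ω hω
    exact congrArg (a < ·) hω.symm

end Coord

/-! ### Isomorphisms of nonatomic standard Borel probability spaces -/

section Isomorphism

variable {Ω Ω' : Type*} [MeasurableSpace Ω] [StandardBorelSpace Ω] [MeasurableSpace Ω']
  [StandardBorelSpace Ω']

-- Transported to `ℝ × ℝ`, only countably many of the vertical lines can have positive measure.
lemma exists_null_not_countable (P : Measure Ω) [IsProbabilityMeasure P] [NullSingletonClass P] :
    ∃ N : Set Ω, MeasurableSet N ∧ P N = 0 ∧ ¬ N.Countable := by
  have hΩ : ¬ Countable Ω := fun _ =>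
    IsProbabilityMeasure.ne_zero P (Measure.measure_univ_eq_zero.1
      ((to_countable (univ : Set Ω)).measure_zero P))
  have hℝ : ¬ Countable (ℝ × ℝ) := fun _ =>
    Cardinal.not_countable_real
      (countable_univ_iff.2 (Prod.mk_right_injective (0 : ℝ)).countable)
  let e : Ω ≃ᵐ ℝ × ℝ := PolishSpace.measurableEquivOfNotCountable hΩ hℝ
  have hline (x : ℝ) : MeasurableSet ((fun ω => (e ω).1) ⁻¹' {x}) :=
    e.measurable.fst (measurableSet_singleton x)
  obtain ⟨x, hx⟩ : ∃ x, x ∉ {x | 0 < P ((fun ω => (e ω).1) ⁻¹' {x})} := by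
    refine (ne_univ_iff_exists_notMem _).1 fun h => Cardinal.not_countable_real (h ▸ ?_)
    exact Measure.countable_meas_pos_of_disjoint_iUnion hline
      (pairwise_disjoint_fiber fun ω => (e ω).1)
  refine ⟨_, hline x, by simpa using hx, fun h => Cardinal.not_countable_real ?_⟩
  have hinj : Function.Injective fun y : ℝ => e.symm (x, y) :=
    e.symm.injective.comp (Prod.mk_right_injective x)
  simpa [preimage_preimage] using h.preimage_of_injOn hinj.injOn

lemma exists_measurableEquiv_eqOn {T : Ω → Ω'} (hT : Measurable T) {A : Set Ω}
    (hA : MeasurableSet A) (hinj : InjOn T A) (hAc : ¬ Aᶜ.Countable)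
    (hTAc : ¬ (T '' A)ᶜ.Countable) : ∃ e : Ω ≃ᵐ Ω', EqOn e T A := by
  classical
  have := hA.standardBorel
  have := hA.compl.standardBorel
  have hemb : MeasurableEmbedding (A.domRestrict T) :=
    (hT.comp measurable_subtype_coe).measurableEmbedding (injOn_iff_injective.1 hinj)
  rw [← range_domRestrict] at hTAc
  have := hemb.measurableSet_range.compl.standardBorel
  refine ⟨(MeasurableEquiv.sumCompl hA).symm.trans ((MeasurableEquiv.sumCongr hemb.equivRange
    (PolishSpace.measurableEquivOfNotCountable hAc hTAc)).trans
      (MeasurableEquiv.sumCompl hemb.measurableSet_range)), fun ω hω => ?_⟩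
  have hsymm : (MeasurableEquiv.sumCompl hA).symm ω = Sum.inl ⟨ω, hω⟩ := by
    rw [MeasurableEquiv.symm_apply_eq]
    rfl
  rw [MeasurableEquiv.trans_apply, MeasurableEquiv.trans_apply, hsymm]
  change ((hemb.equivRange ⟨ω, hω⟩ : range (A.domRestrict T)) : Ω') = T ω
  rw [hemb.equivRange_apply]
  rfl

theorem exists_measurableEquiv_ae_eq {P : Measure Ω} {P' : Measure Ω'} [IsProbabilityMeasure P]
    [NullSingletonClass P] [IsProbabilityMeasure P'] [NullSingletonClass P'] {T : Ω → Ω'}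
    (hT : MeasurePreserving T P P') {A : Set Ω} (hA : MeasurableSet A) (hPA : P Aᶜ = 0)
    (hinj : InjOn T A) : ∃ e : Ω ≃ᵐ Ω', MeasurePreserving e P P' ∧ e =ᵐ[P] T := by
  -- Removing uncountable null sets on both sides leaves room to extend `T` to an isomorphism.
  obtain ⟨N, hN, hPN, hNc⟩ := exists_null_not_countable P
  obtain ⟨N', hN', hPN', hNc'⟩ := exists_null_not_countable P'
  obtain ⟨e, he⟩ := exists_measurableEquiv_eqOn (A := A \ (N ∪ T ⁻¹' N')) hT.measurable
    (hA.diff (hN.union (hT.measurable hN'))) (hinj.mono sdiff_subset)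
    (mt (Countable.mono fun ω hω hωA => hωA.2 (Or.inl hω)) hNc)
    (mt (Countable.mono fun _ hω' ⟨ω, hω, hωω'⟩ => hω.2 (Or.inr (by simpa [hωω']))) hNc')
  have hae : e =ᵐ[P] T := by
    filter_upwards [measure_eq_zero_iff_ae_notMem.1 hPA, measure_eq_zero_iff_ae_notMem.1 hPN,
      hT.quasiMeasurePreserving.ae (measure_eq_zero_iff_ae_notMem.1 hPN')] with ω hωA hωN hωN'
    exact he ⟨not_not.1 hωA, not_or.2 ⟨hωN, hωN'⟩⟩
  exact ⟨e, ⟨e.measurable, by rw [Measure.map_congr hae, hT.map_eq]⟩, hae⟩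

end Isomorphism

section Cdf

lemma strictMonoOn_setOf_ne_ratCast {f : ℝ → ℝ} (hf : Monotone f) :
    StrictMonoOn f {x | ∀ q : ℚ, f x ≠ f q} := fun x hx y _ hxy => by
  obtain ⟨q, hxq, hqy⟩ := exists_rat_btwn hxy
  exact (lt_of_le_of_ne (hf hxq.le) (hx q)).trans_le (hf hqy.le)

variable (μ : Measure ℝ) [IsProbabilityMeasure μ] [NullSingletonClass μ]

lemma continuous_cdf : Continuous (cdf μ) := by
  refine continuous_iff_continuousAt.2 fun x => ?_
  rw [(cdf μ).mono.continuousAt_iff_leftLim_eq_rightLim, (cdf μ).rightLim_eq]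
  refine le_antisymm ((cdf μ).mono.leftLim_le le_rfl) ?_
  have hjump := (cdf μ).measure_singleton x
  rw [measure_cdf, measure_singleton, eq_comm, ENNReal.ofReal_eq_zero] at hjump
  linarith

lemma exists_cdf_eq {u : ℝ} (hu₀ : 0 < u) (hu₁ : u < 1) : ∃ x, cdf μ x = u :=
  mem_range_of_exists_le_of_exists_ge (continuous_cdf μ)
    (((tendsto_cdf_atBot μ).eventually_lt_const hu₀).exists.imp fun _ => le_of_lt)
    (((tendsto_cdf_atTop μ).eventually_const_lt hu₁).exists.imp fun _ => le_of_lt)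

lemma measureReal_cdf_le {u : ℝ} (hu₀ : 0 ≤ u) (hu₁ : u < 1) :
    μ.real {x | cdf μ x ≤ u} = u := by
  apply le_antisymm
  · refine ge_of_tendsto (tendsto_id.mono_left nhdsWithin_le_nhds : Tendsto id (𝓝[>] u) (𝓝 u)) ?_
    filter_upwards [Ioo_mem_nhdsGT hu₁] with v hv
    obtain ⟨t, rfl⟩ := exists_cdf_eq μ (hu₀.trans_lt hv.1) hv.2
    rw [id, cdf_eq_real]
    refine measureReal_mono fun x hx => ?_
    exact le_of_not_gt fun htx => (hv.1.trans_le ((cdf μ).mono (le_of_lt htx))).not_ge hx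
  · obtain rfl | hu₀ := hu₀.eq_or_lt
    · exact measureReal_nonneg
    obtain ⟨s, rfl⟩ := exists_cdf_eq μ hu₀ hu₁
    conv_lhs => rw [cdf_eq_real]
    exact measureReal_mono fun x hx => (cdf μ).mono hx

/-- The uniform distribution on the unit interval, as a measure on the line. -/
noncomputable abbrev uniform : Measure ℝ := volume.restrict (Ioc 0 1)

instance : IsProbabilityMeasure uniform := ⟨by simp⟩

lemma map_cdf : μ.map (cdf μ) = uniform := by
  have hF := (continuous_cdf μ).measurable
  have := Measure.isProbabilityMeasure_map (μ := μ) hF.aemeasurable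
  refine Measure.ext_of_Iic _ _ fun u => ?_
  rw [Measure.map_apply hF measurableSet_Iic, Measure.restrict_apply measurableSet_Iic,
    inter_comm, Ioc_inter_Iic, Real.volume_Ioc, sub_zero]
  change μ {x | cdf μ x ≤ u} = _
  rcases lt_or_ge u 0 with hu₀ | hu₀
  · rw [ENNReal.ofReal_of_nonpos ((min_le_right _ _).trans hu₀.le)]
    convert! measure_empty (μ := μ)
    exact eq_empty_of_forall_notMem fun x hx => (hu₀.trans_le (cdf_nonneg μ x)).not_ge hx
  rcases lt_or_ge u 1 with hu₁ | hu₁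
  · rw [min_eq_right hu₁.le, ← measureReal_cdf_le μ hu₀ hu₁, ofReal_measureReal]
    simp [measureReal_cdf_le μ hu₀ hu₁]
  · rw [min_eq_left hu₁, ENNReal.ofReal_one, ← measure_univ (μ := μ)]
    exact congrArg μ (eq_univ_of_forall fun x => (cdf_le_one μ x).trans hu₁)

end Cdf

section Labelled

variable {Ω Ω' : Type*} [MeasurableSpace Ω] [StandardBorelSpace Ω] [MeasurableSpace Ω']
  [StandardBorelSpace Ω'] {P : Measure Ω} {P' : Measure Ω'} [IsProbabilityMeasure P]
  [NullSingletonClass P] [IsProbabilityMeasure P'] [NullSingletonClass P']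

lemma exists_measurableEquiv_uniform {ξ : Ω → ℝ} (hξ : MeasurableEmbedding ξ) :
    ∃ e : Ω ≃ᵐ ℝ, MeasurePreserving e P uniform ∧ ∀ᵐ ω ∂P, e ω = cdf (P.map ξ) (ξ ω) := by
  have := Measure.isProbabilityMeasure_map (μ := P) hξ.measurable.aemeasurable
  have : NullSingletonClass (P.map ξ) := ⟨fun x => by
    rw [Measure.map_apply hξ.measurable (measurableSet_singleton x)]
    exact (subsingleton_singleton.preimage hξ.injective).measure_zero P⟩
  let F := cdf (P.map ξ)
  have hF : Measurable F := (continuous_cdf _).measurable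
  have hFξ : MeasurePreserving (F ∘ ξ) P uniform :=
    ⟨hF.comp hξ.measurable, by rw [← map_cdf (P.map ξ), Measure.map_map hF hξ.measurable]⟩
  let A : Set Ω := ⋂ q : ℚ, {ω | F (ξ ω) = F q}ᶜ
  have hA : MeasurableSet A := .iInter fun q =>
    (measurableSet_eq_fun hFξ.measurable measurable_const).compl
  have hPA : P Aᶜ = 0 := by
    simp only [A, compl_iInter, compl_compl, measure_iUnion_null_iff]
    intro q
    exact (hFξ.measure_preimage (measurableSet_singleton _).nullMeasurableSet).trans
      (measure_singleton _)
  refine exists_measurableEquiv_ae_eq hFξ hA hPA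
    ((strictMonoOn_setOf_ne_ratCast F.mono).injOn.comp hξ.injective.injOn fun ω hω q => ?_)
  exact mem_iInter.1 hω q

lemma floor_natCast_add_coord (n : ℕ) (ω : Ω) : ⌊n + coord Ω ω⌋₊ = n := by
  rw [Nat.floor_eq_iff (add_nonneg n.cast_nonneg (coord_pos ω).le)]
  exact ⟨by linarith [coord_pos ω], by linarith [coord_lt_one ω]⟩

lemma measurableEmbedding_natCast_add_coord {κ : Ω → ℕ} (hκ : Measurable κ) :
    MeasurableEmbedding fun ω => κ ω + coord Ω ω := by
  refine ((measurable_from_top.comp hκ).add (measurable_coord Ω)).measurableEmbedding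
    fun ω ω' (h : κ ω + coord Ω ω = κ ω' + coord Ω ω') => ?_
  have hκ : κ ω = κ ω' := by
    rw [← floor_natCast_add_coord (κ ω) ω, h, floor_natCast_add_coord]
  exact coord_injective Ω (add_left_cancel (hκ ▸ h))

omit [NullSingletonClass P] in
lemma cdf_map_natCast_add_coord {κ : Ω → ℕ} (hκ : Measurable κ) (i : ℕ) :
    cdf (P.map fun ω => κ ω + coord Ω ω) i = (P.map κ).real (Iio i) := by
  have hξ := (measurableEmbedding_natCast_add_coord hκ).measurable
  have := Measure.isProbabilityMeasure_map (μ := P) hξ.aemeasurable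
  rw [cdf_eq_real, map_measureReal_apply hξ measurableSet_Iic,
    map_measureReal_apply hκ measurableSet_Iio]
  congr 1
  ext ω
  simp only [mem_preimage, mem_Iic, mem_Iio]
  constructor <;> intro h
  · have : (κ ω : ℝ) < i := by linarith [coord_pos ω]
    exact_mod_cast this
  · have : (κ ω : ℝ) + 1 ≤ i := by exact_mod_cast h
    linarith [coord_lt_one ω]

lemma exists_measurableEquiv_uniform_labelled {κ : Ω → ℕ} (hκ : Measurable κ) :
    ∃ e : Ω ≃ᵐ ℝ, MeasurePreserving e P uniform ∧
      ∀ᵐ ω ∂P, e ω ∈ Ioo ((P.map κ).real (Iio (κ ω))) ((P.map κ).real (Iio (κ ω + 1))) := by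
  obtain ⟨e, he, heF⟩ := exists_measurableEquiv_uniform (P := P)
    (measurableEmbedding_natCast_add_coord hκ)
  refine ⟨e, he, ?_⟩
  have hne : ∀ᵐ ω ∂P, e ω ∉ range fun i : ℕ => (P.map κ).real (Iio i) :=
    he.quasiMeasurePreserving.ae
      (measure_eq_zero_iff_ae_notMem.1 ((countable_range _).measure_zero _))
  filter_upwards [heF, hne] with ω hω hωne
  refine ⟨lt_of_le_of_ne ?_ fun h => hωne ⟨_, h⟩, lt_of_le_of_ne ?_ fun h => hωne ⟨_, h.symm⟩⟩ <;>
    rw [hω, ← cdf_map_natCast_add_coord hκ] <;>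
    apply (cdf _).mono
  · linarith [coord_pos ω]
  · push_cast
    linarith [coord_lt_one ω]

theorem exists_measurableEquiv_labelled {κ : Ω → ℕ} {κ' : Ω' → ℕ} (hκ : Measurable κ)
    (hκ' : Measurable κ') (h : P.map κ = P'.map κ') :
    ∃ e : Ω ≃ᵐ Ω', MeasurePreserving e P P' ∧ ∀ᵐ ω ∂P, κ' (e ω) = κ ω := by
  obtain ⟨e₁, he₁, hκe₁⟩ := exists_measurableEquiv_uniform_labelled (P := P) hκ
  obtain ⟨e₂, he₂, hκe₂⟩ := exists_measurableEquiv_uniform_labelled (P := P') hκ'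
  have he : MeasurePreserving (e₁.trans e₂.symm) P P' := (he₂.symm e₂).comp he₁
  refine ⟨e₁.trans e₂.symm, he, ?_⟩
  filter_upwards [hκe₁, he.quasiMeasurePreserving.ae hκe₂] with ω hω hω'
  rw [MeasurableEquiv.trans_apply, MeasurableEquiv.apply_symm_apply, ← h] at hω'
  have hmono : Monotone fun i : ℕ => (P.map κ).real (Iio i) :=
    fun i j hij => measureReal_mono (Iio_subset_Iio hij)
  exact le_antisymm (Nat.lt_succ_iff.1 (hmono.reflect_lt (hω'.1.trans hω.2)))
    (Nat.lt_succ_iff.1 (hmono.reflect_lt (hω.1.trans hω'.2)))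

end Labelled

/-! ### Pointwise convergence of nonexpansive maps -/

section Nonexpansive

variable {ι α β : Type*} [PseudoMetricSpace α] [PseudoMetricSpace β] {l : Filter ι}
  {Φ : ι → α → β}

lemma isClosed_setOf_tendsto {Φ₀ : α → β} (hΦ : ∀ i, LipschitzWith 1 (Φ i))
    (hΦ₀ : LipschitzWith 1 Φ₀) : IsClosed {x | Tendsto (fun i => Φ i x) l (𝓝 (Φ₀ x))} := by
  refine isClosed_of_closure_subset fun x hx => Metric.tendsto_nhds.2 fun ε hε => ?_
  obtain ⟨y, hy, hxy⟩ := Metric.mem_closure_iff.1 hx (ε / 3) (by positivity)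
  filter_upwards [Metric.tendsto_nhds.1 hy (ε / 3) (by positivity)] with i hi
  calc dist (Φ i x) (Φ₀ x)
      ≤ dist (Φ i x) (Φ i y) + dist (Φ i y) (Φ₀ y) + dist (Φ₀ y) (Φ₀ x) := dist_triangle4 ..
    _ ≤ dist x y + dist (Φ i y) (Φ₀ y) + dist x y := by
        gcongr
        · exact (hΦ i).dist_le_mul x y |>.trans_eq (by simp)
        · exact hΦ₀.dist_le_mul y x |>.trans_eq (by simp [dist_comm])
    _ < ε / 3 + ε / 3 + ε / 3 := by gcongr
    _ = ε := by ring

lemma isClosed_setOf_exists_tendsto [CompleteSpace β] [NeBot l] (hΦ : ∀ i, LipschitzWith 1 (Φ i)) :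
    IsClosed {x | ∃ y, Tendsto (fun i => Φ i x) l (𝓝 y)} := by
  simp_rw [← cauchy_map_iff_exists_tendsto]
  refine isClosed_of_closure_subset fun x hx => Metric.cauchy_iff.2 ⟨inferInstance, fun ε hε => ?_⟩
  obtain ⟨y, hy, hxy⟩ := Metric.mem_closure_iff.1 hx (ε / 3) (by positivity)
  obtain ⟨t, ht, htε⟩ := (Metric.cauchy_iff.1 hy).2 (ε / 3) (by positivity)
  refine ⟨(fun i => Φ i x) '' {i | Φ i y ∈ t}, image_mem_map ht, ?_⟩
  rintro _ ⟨i, hi, rfl⟩ _ ⟨j, hj, rfl⟩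
  calc dist (Φ i x) (Φ j x)
      ≤ dist (Φ i x) (Φ i y) + dist (Φ i y) (Φ j y) + dist (Φ j y) (Φ j x) := dist_triangle4 ..
    _ ≤ dist x y + dist (Φ i y) (Φ j y) + dist x y := by
        gcongr
        · exact (hΦ i).dist_le_mul x y |>.trans_eq (by simp)
        · exact (hΦ j).dist_le_mul y x |>.trans_eq (by simp [dist_comm])
    _ < ε / 3 + ε / 3 + ε / 3 := by
        gcongr
        exact htε _ hi _ hj
    _ = ε := by ring

end Nonexpansive

section TendstoSubmodule

variable {ι R E F : Type*} [Semiring R] [AddCommMonoid E] [Module R E] [AddCommMonoid F]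
  [Module R F] [TopologicalSpace F] [ContinuousAdd F] [ContinuousConstSMul R F]

/-- The submodule of the points at which the linear maps `Φ i` converge to `Φ₀` along `l`. -/
def tendstoSubmodule (Φ : ι → E →ₗ[R] F) (l : Filter ι) (Φ₀ : E →ₗ[R] F) : Submodule R E where
  carrier := {x | Tendsto (fun i => Φ i x) l (𝓝 (Φ₀ x))}
  zero_mem' := by simpa using tendsto_const_nhds
  add_mem' hx hy := by simpa using hx.add hy
  smul_mem' c _ hx := by simpa using hx.const_smul c

end TendstoSubmodule

/-! ### Sub-σ-fields as orthogonal projections -/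

namespace SubSigmaField

section Projection

variable {Ω : Type*} [mΩ : MeasurableSpace Ω] {P : Measure Ω}

/-- The closed subspace `L₂(E)`. -/
noncomputable abbrev space (E : SubSigmaField P) : Submodule ℝ (Lp ℝ 2 P) :=
  lpMeas ℝ ℝ E.toMeasurableSpace 2 P

instance (E : SubSigmaField P) : E.space.HasOrthogonalProjection :=
  haveI : Fact (E.toMeasurableSpace ≤ mΩ) := ⟨E.le⟩
  inferInstance

lemma isClosed_space (E : SubSigmaField P) : IsClosed (E.space : Set (Lp ℝ 2 P)) :=
  isClosed_aestronglyMeasurable E.le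

/-- The conditional expectation given `E`, as the orthogonal projection of `L₂` onto `L₂(E)`. -/
noncomputable abbrev proj (E : SubSigmaField P) : Lp ℝ 2 P →L[ℝ] Lp ℝ 2 P := E.space.starProjection

lemma proj_mem (E : SubSigmaField P) (f : Lp ℝ 2 P) : E.proj f ∈ E.space :=
  Submodule.starProjection_apply_mem _ _

lemma proj_eq_self {E : SubSigmaField P} {f : Lp ℝ 2 P} : E.proj f = f ↔ f ∈ E.space :=
  Submodule.starProjection_eq_self_iff

lemma lipschitzWith_proj (E : SubSigmaField P) : LipschitzWith 1 E.proj :=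
  LipschitzWith.of_dist_le_mul fun f g => by
    rw [dist_eq_norm, dist_eq_norm, ← map_sub, NNReal.coe_one, one_mul]
    exact Submodule.norm_starProjection_apply_le _ _

/-- The distance from `f` to `L₂(E)`, whose minimum with `1` defines the Wijsman topology. -/
noncomputable abbrev infDist (E : SubSigmaField P) (f : Lp ℝ 2 P) : ℝ :=
  Metric.infDist f (E.space : Set (Lp ℝ 2 P))

lemma infDist_eq_norm_sub_proj (E : SubSigmaField P) (f : Lp ℝ 2 P) :
    E.infDist f = ‖f - E.proj f‖ := by
  rw [infDist, Metric.infDist_eq_iInf, Submodule.starProjection_minimal]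
  simp_rw [dist_eq_norm]
  rfl

lemma infDist_le (E : SubSigmaField P) (f : Lp ℝ 2 P) {g : Lp ℝ 2 P} (hg : g ∈ E.space) :
    E.infDist f ≤ ‖f - g‖ := by
  simpa only [dist_eq_norm] using Metric.infDist_le_dist_of_mem (x := f) hg

lemma infDist_le_norm (E : SubSigmaField P) (f : Lp ℝ 2 P) : E.infDist f ≤ ‖f‖ := by
  simpa using E.infDist_le f E.space.zero_mem

lemma infDist_eq_zero {E : SubSigmaField P} {f : Lp ℝ 2 P} : E.infDist f = 0 ↔ f ∈ E.space :=
  (E.isClosed_space.mem_iff_infDist_zero E.space.nonempty).symm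

lemma infDist_smul (E : SubSigmaField P) (c : ℝ) (f : Lp ℝ 2 P) :
    E.infDist (c • f) = |c| * E.infDist f := by
  simp only [infDist_eq_norm_sub_proj, map_smul, ← smul_sub, norm_smul, Real.norm_eq_abs]

lemma lipschitzWith_infDist (E : SubSigmaField P) : LipschitzWith 1 E.infDist :=
  Metric.lipschitz_infDist_pt _

lemma norm_sq_eq (E : SubSigmaField P) (f : Lp ℝ 2 P) :
    ‖f‖ ^ 2 = ‖E.proj f‖ ^ 2 + E.infDist f ^ 2 := by
  rw [E.space.norm_sq_eq_add_norm_sq_starProjection f, Submodule.starProjection_orthogonal',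
    infDist_eq_norm_sub_proj]
  rfl

lemma norm_proj (E : SubSigmaField P) (f : Lp ℝ 2 P) :
    ‖E.proj f‖ = √(‖f‖ ^ 2 - E.infDist f ^ 2) := by
  rw [E.norm_sq_eq f, add_sub_cancel_right, Real.sqrt_sq (norm_nonneg _)]

end Projection

section WijsmanTopology

variable {Ω : Type*} [MeasurableSpace Ω] {P : Measure Ω}

lemma isInducing_min_infEDist :
    IsInducing fun (E : SubSigmaField P) (f : Lp ℝ 2 P) =>
      min 1 (Metric.infEDist f (E.space : Set (Lp ℝ 2 P))) :=
  ⟨induced_compose (f := toClosedSubspace)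
    (g := fun (F : TopologicalSpace.Closeds (Lp ℝ 2 P)) (f : Lp ℝ 2 P) =>
      min 1 (Metric.infEDist f (F : Set (Lp ℝ 2 P))))⟩

lemma continuous_infDist (f : Lp ℝ 2 P) : Continuous fun E : SubSigmaField P => E.infDist f := by
  -- Scaling `f` into the unit ball makes the truncation at `1` ineffective.
  let c : ℝ := (‖f‖ + 1)⁻¹
  have hc : 0 < c := by positivity
  have hle (E : SubSigmaField P) : E.infDist (c • f) ≤ 1 := by
    refine (E.infDist_le_norm _).trans ?_
    rw [norm_smul, Real.norm_eq_abs, abs_of_pos hc, inv_mul_le_iff₀ (by positivity)]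
    linarith
  have hinfDist (E : SubSigmaField P) : E.infDist f =
      c⁻¹ * (min 1 (Metric.infEDist (c • f) (E.space : Set (Lp ℝ 2 P)))).toReal := by
    rw [min_eq_right, ← Metric.infDist, ← infDist, infDist_smul, abs_of_pos hc,
      inv_mul_cancel_left₀ hc.ne']
    rw [← ENNReal.ofReal_toReal (Metric.infEDist_ne_top E.space.nonempty)]
    exact ENNReal.ofReal_le_one.2 (hle E)
  simp_rw [hinfDist]
  refine continuous_const.mul (ENNReal.continuousOn_toReal.comp_continuous
    ((continuous_pi_iff.1 isInducing_min_infEDist.continuous) (c • f)) fun E => ?_)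
  exact ((min_le_left _ _).trans_lt ENNReal.one_lt_top).ne

lemma isInducing_infDist : IsInducing (infDist : SubSigmaField P → Lp ℝ 2 P → ℝ) := by
  refine .of_comp (g := fun (u : Lp ℝ 2 P → ℝ) f => min 1 (ENNReal.ofReal (u f)))
    (continuous_pi continuous_infDist) (continuous_pi fun f =>
      continuous_const.min (ENNReal.continuous_ofReal.comp (continuous_apply f))) ?_
  convert! isInducing_min_infEDist (P := P) using 3 with E f
  exact congrArg (min 1) <| ENNReal.ofReal_toReal (Metric.infEDist_ne_top E.space.nonempty)

lemma continuous_norm_proj (f : Lp ℝ 2 P) : Continuous fun E : SubSigmaField P => ‖E.proj f‖ := by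
  simp_rw [norm_proj]
  exact Real.continuous_sqrt.comp (continuous_const.sub ((continuous_infDist f).pow 2))

lemma continuous_proj (f : Lp ℝ 2 P) : Continuous fun E : SubSigmaField P => E.proj f := by
  refine continuous_iff_continuousAt.2 fun E₀ => tendsto_iff_dist_tendsto_zero.2 ?_
  let g := E₀.proj f
  have hle (E : SubSigmaField P) : dist (E.proj f) g ≤ E.infDist g + ‖E.proj (f - g)‖ := by
    rw [dist_eq_norm, infDist_eq_norm_sub_proj, norm_sub_rev g]
    refine (congrArg norm ?_).trans_le (norm_add_le _ _)
    rw [map_sub]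
    abel
  refine squeeze_zero (fun _ => dist_nonneg) hle ?_
  have hzero : E₀.infDist g + ‖E₀.proj (f - g)‖ = 0 := by
    rw [infDist_eq_zero.2 (E₀.proj_mem f), map_sub, proj_eq_self.2 (E₀.proj_mem f), sub_self,
      norm_zero, add_zero]
  rw [← hzero]
  exact ((continuous_infDist g).add (continuous_norm_proj (f - g))).tendsto E₀

lemma isInducing_proj {ι : Type*} {d : ι → Lp ℝ 2 P} (hd : DenseRange d) :
    IsInducing fun (E : SubSigmaField P) i => E.proj (d i) := by
  refine isInducing_iff_nhds.2 fun E₀ => le_antisymm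
    ((continuous_pi fun i => continuous_proj (d i)).tendsto E₀).le_comap ?_
  rw [← tendsto_id', isInducing_infDist.tendsto_nhds_iff, tendsto_pi_nhds]
  refine fun f => (isClosed_setOf_tendsto (fun E : SubSigmaField P => E.lipschitzWith_infDist)
    E₀.lipschitzWith_infDist).closure_subset_iff.2 ?_ (hd f)
  rintro _ ⟨i, rfl⟩
  simp only [mem_ofPred_eq, infDist_eq_norm_sub_proj]
  exact (tendsto_const_nhds.sub
    (tendsto_pi_nhds.1 (tendsto_comap (f := fun (E : SubSigmaField P) i => E.proj (d i))) i)).norm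

end WijsmanTopology

section Lattice

variable {Ω : Type*} [MeasurableSpace Ω] {P : Measure Ω}

lemma space_mono {E F : SubSigmaField P} (h : E.toMeasurableSpace ≤ F.toMeasurableSpace) :
    E.space ≤ F.space := fun _ hf => AEStronglyMeasurable.mono h hf

lemma abs_mem_space {E : SubSigmaField P} {f : Lp ℝ 2 P} (hf : f ∈ E.space) : |f| ∈ E.space := by
  obtain ⟨g, hg, hfg⟩ := hf
  refine ⟨fun x => |g x|, continuous_abs.comp_stronglyMeasurable hg, ?_⟩
  filter_upwards [hfg, Lp.coeFn_abs f] with x hx habs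
  rw [habs, hx]

variable [IsFiniteMeasure P]

lemma indicatorLp_mem_space {E : SubSigmaField P} {s : Set Ω} (hs : MeasurableSet s) :
    indicatorLp P hs ∈ E.space ↔ MeasurableSet[E.toMeasurableSpace] s := by
  refine ⟨fun ⟨g, hg, hgs⟩ => ?_, fun h => mem_lpMeas_indicatorConstLp E.le h _⟩
  have hg₁ : MeasurableSet[E.toMeasurableSpace] {x | g x = 1} :=
    hg.measurable (measurableSet_singleton 1)
  refine E.measurableSet_congr (E.le _ hg₁) hs ?_ hg₁
  filter_upwards [hgs, coeFn_indicatorLp (P := P) hs] with x hx hsx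
  change (g x = 1) = (x ∈ s)
  rw [← hx, hsx]
  by_cases hxs : x ∈ s <;> simp [hxs]

lemma indicatorLp_univ_mem_space (E : SubSigmaField P) :
    indicatorLp P MeasurableSet.univ ∈ E.space :=
  (indicatorLp_mem_space _).2 MeasurableSet.univ

lemma le_of_space_le {E F : SubSigmaField P} (h : E.space ≤ F.space) :
    E.toMeasurableSpace ≤ F.toMeasurableSpace := fun s hs =>
  (indicatorLp_mem_space (E.le s hs)).1 (h ((indicatorLp_mem_space _).2 hs))

lemma space_injective : Function.Injective (space : SubSigmaField P → _) := fun _ _ h =>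
  SubSigmaField.ext (le_antisymm (le_of_space_le h.le) (le_of_space_le h.ge))

lemma le_iff_infDist_le {E F : SubSigmaField P} :
    E.toMeasurableSpace ≤ F.toMeasurableSpace ↔ ∀ f, F.infDist f ≤ E.infDist f := by
  refine ⟨fun h f => Metric.infDist_le_infDist_of_subset (space_mono h) E.space.nonempty,
    fun h => le_of_space_le fun f hf => infDist_eq_zero.1 ?_⟩
  exact le_antisymm ((h f).trans_eq (infDist_eq_zero.2 hf)) Metric.infDist_nonneg

/-- The sub-σ-field of the sets whose indicators belong to a closed sublattice of `L₂`. -/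
def ofSublattice (K : Submodule ℝ (Lp ℝ 2 P)) (hK : IsClosed (K : Set (Lp ℝ 2 P)))
    (habs : ∀ f ∈ K, |f| ∈ K) (huniv : indicatorLp P MeasurableSet.univ ∈ K) :
    SubSigmaField P where
  toMeasurableSpace :=
    { MeasurableSet' := fun s => ∃ hs : MeasurableSet s, indicatorLp P hs ∈ K
      measurableSet_empty := ⟨MeasurableSet.empty, by
        rw [indicatorLp_eq_zero _ measure_empty]
        exact K.zero_mem⟩
      measurableSet_compl := fun s ⟨hs, h⟩ => ⟨hs.compl, by
        rw [indicatorLp_compl hs]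
        exact K.sub_mem huniv h⟩
      measurableSet_iUnion := fun f hf => by
        choose hfm hfK using hf
        exact ⟨.iUnion hfm, indicatorLp_iUnion_mem_of_abs_mem (by simp) hK habs hfm hfK⟩ }
  le := fun s hs => hs.1
  measurableSet_of_null := fun s hs hPs => ⟨hs, by
    rw [indicatorLp_eq_zero hs hPs]
    exact K.zero_mem⟩

theorem space_ofSublattice {K : Submodule ℝ (Lp ℝ 2 P)} (hK : IsClosed (K : Set (Lp ℝ 2 P)))
    (habs : ∀ f ∈ K, |f| ∈ K) (huniv : indicatorLp P MeasurableSet.univ ∈ K) :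
    (ofSublattice K hK habs huniv).space = K := by
  set E := ofSublattice K hK habs huniv
  refine le_antisymm ?_ fun f hf => ?_
  · exact lpMeas_le_of_generateFrom (by simp) hK E.le
      (@MeasurableSpace.generateFrom_measurableSet Ω E.toMeasurableSpace).symm
      (@MeasurableSpace.isPiSystem_measurableSet Ω E.toMeasurableSpace) huniv
      fun s hs _ => hs.elim fun _ h => h
  · have : Measurable[E.toMeasurableSpace] f :=
      measurable_of_Ioi fun a => ⟨_, indicatorLp_lt_mem (by simp) hK habs huniv hf a⟩
    exact this.stronglyMeasurable.aestronglyMeasurable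

end Lattice

/-! ### The space of sub-σ-fields is Polish -/

section Polish

variable {Ω : Type*} [MeasurableSpace Ω] {P : Measure Ω}

/-- The elements of `L₂` that are limits of their conditional expectations along a filter. -/
noncomputable abbrev limitSpace (l : Filter (SubSigmaField P)) : Submodule ℝ (Lp ℝ 2 P) :=
  tendstoSubmodule (fun E => E.proj.toLinearMap) l .id

lemma isClosed_limitSpace (l : Filter (SubSigmaField P)) :
    IsClosed (limitSpace l : Set (Lp ℝ 2 P)) :=
  isClosed_setOf_tendsto (fun E => E.lipschitzWith_proj) .id

lemma mem_limitSpace_of_tendsto {l : Filter (SubSigmaField P)} {u : SubSigmaField P → Lp ℝ 2 P}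
    {f : Lp ℝ 2 P} (hu : ∀ E, u E ∈ E.space) (hf : Tendsto u l (𝓝 f)) : f ∈ limitSpace l := by
  refine tendsto_iff_norm_sub_tendsto_zero.2 (squeeze_zero (fun _ => norm_nonneg _) (fun E => ?_)
    (tendsto_iff_norm_sub_tendsto_zero.1 hf))
  rw [norm_sub_rev, norm_sub_rev (u E)]
  exact (E.infDist_eq_norm_sub_proj f).symm.trans_le (E.infDist_le f (hu E))

variable [IsFiniteMeasure P]

lemma exists_space_eq_limitSpace (l : Filter (SubSigmaField P)) :
    ∃ E : SubSigmaField P, E.space = limitSpace l := by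
  refine ⟨_, space_ofSublattice (isClosed_limitSpace l) (fun f hf => ?_) ?_⟩
  · have habs : Continuous fun f : Lp ℝ 2 P => |f| := continuous_id.sup continuous_id.neg
    exact mem_limitSpace_of_tendsto (u := fun E => |E.proj f|)
      (fun E => abs_mem_space (E.proj_mem f)) ((habs.tendsto f).comp hf)
  · exact mem_limitSpace_of_tendsto (fun E => E.indicatorLp_univ_mem_space) tendsto_const_nhds

lemma exists_proj_eq_of_tendsto {l : Filter (SubSigmaField P)} [NeBot l]
    {Q : Lp ℝ 2 P → Lp ℝ 2 P}
    (hQ : ∀ f, Tendsto (fun E : SubSigmaField P => E.proj f) l (𝓝 (Q f))) :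
    ∃ E : SubSigmaField P, ∀ f, E.proj f = Q f := by
  obtain ⟨E, hE⟩ := exists_space_eq_limitSpace l
  refine ⟨E, fun f => Submodule.eq_starProjection_of_mem_of_inner_eq_zero ?_ fun g hg => ?_⟩
  · rw [hE]
    exact mem_limitSpace_of_tendsto (fun E => E.proj_mem f) (hQ f)
  · rw [hE] at hg
    refine tendsto_nhds_unique (((tendsto_const_nhds (x := f)).sub (hQ f)).inner hg)
      (tendsto_const_nhds.congr fun F => ?_)
    exact (Submodule.starProjection_inner_eq_zero _ _ (F.proj_mem g)).symm

lemma isClosed_range_proj {ι : Type*} {d : ι → Lp ℝ 2 P} (hd : DenseRange d) :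
    IsClosed (range fun (E : SubSigmaField P) i => E.proj (d i)) := by
  refine isClosed_of_closure_subset fun y hy => ?_
  let projs (E : SubSigmaField P) i := E.proj (d i)
  let l := comap projs (𝓝 y)
  have : NeBot l := comap_neBot_iff.2 fun t ht => by
    obtain ⟨_, hz, E, rfl⟩ := mem_closure_iff_nhds.1 hy t ht
    exact ⟨E, hz⟩
  have hl (i) : Tendsto (fun E : SubSigmaField P => E.proj (d i)) l (𝓝 (y i)) :=
    tendsto_pi_nhds.1 (tendsto_comap (f := projs)) i
  have hex (f) : ∃ g, Tendsto (fun E : SubSigmaField P => E.proj f) l (𝓝 g) := by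
    refine (isClosed_setOf_exists_tendsto
      fun E : SubSigmaField P => E.lipschitzWith_proj).closure_subset_iff.2 ?_ (hd f)
    rintro _ ⟨i, rfl⟩
    exact ⟨y i, hl i⟩
  choose Q hQ using hex
  obtain ⟨E, hE⟩ := exists_proj_eq_of_tendsto hQ
  exact ⟨E, funext fun i => (hE (d i)).trans (tendsto_nhds_unique (hQ (d i)) (hl i))⟩

lemma isClosedEmbedding_proj {ι : Type*} {d : ι → Lp ℝ 2 P} (hd : DenseRange d) :
    IsClosedEmbedding fun (E : SubSigmaField P) i => E.proj (d i) := by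
  refine ⟨⟨isInducing_proj hd, fun E F h => space_injective ?_⟩, isClosed_range_proj hd⟩
  have hproj : (E.proj : Lp ℝ 2 P → Lp ℝ 2 P) = F.proj :=
    hd.equalizer E.proj.continuous F.proj.continuous h
  ext f
  rw [← proj_eq_self, ← proj_eq_self, hproj]

instance [MeasurableSpace.CountablyGenerated Ω] : PolishSpace (Lp ℝ 2 P) := by
  have : Fact ((2 : ℝ≥0∞) ≠ ∞) := ⟨by simp⟩
  infer_instance

instance [MeasurableSpace.CountablyGenerated Ω] : PolishSpace (SubSigmaField P) :=
  (isClosedEmbedding_proj (TopologicalSpace.denseRange_denseSeq (Lp ℝ 2 P))).polishSpace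

end Polish

/-! ### The trivial sub-σ-field -/

section Completion

variable {Ω : Type*} {m m' : MeasurableSpace Ω} [mΩ : MeasurableSpace Ω] {P : Measure Ω}

variable (m P) in
/-- The sub-σ-field generated by a σ-field and the null sets. -/
def completion : SubSigmaField P where
  toMeasurableSpace := eventuallyMeasurableSpace m (ae P) ⊓ mΩ
  le := inf_le_right
  measurableSet_of_null _ hs hPs := MeasurableSpace.measurableSet_inf.2
    ⟨⟨∅, @MeasurableSet.empty Ω m, ae_eq_empty.2 hPs⟩, hs⟩

lemma measurableSet_completion {s : Set Ω} :
    MeasurableSet[(completion m P).toMeasurableSpace] s ↔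
      (∃ t, MeasurableSet[m] t ∧ s =ᵐ[P] t) ∧ MeasurableSet s :=
  MeasurableSpace.measurableSet_inf

lemma le_completion (hm : m ≤ mΩ) : m ≤ (completion m P).toMeasurableSpace := fun s hs =>
  measurableSet_completion.2 ⟨⟨s, hs, .rfl⟩, hm s hs⟩

lemma completion_mono (h : m ≤ m') :
    (completion m P).toMeasurableSpace ≤ (completion m' P).toMeasurableSpace := fun s hs => by
  obtain ⟨⟨t, ht, hst⟩, hs'⟩ := measurableSet_completion.1 hs
  exact measurableSet_completion.2 ⟨⟨t, h t ht, hst⟩, hs'⟩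

lemma space_completion [IsFiniteMeasure P] (hm : m ≤ mΩ) :
    (completion m P).space = lpMeas ℝ ℝ m 2 P := by
  refine le_antisymm ?_ fun f hf => AEStronglyMeasurable.mono (le_completion hm) hf
  have hmem {s : Set Ω} (hs : MeasurableSet[m] s) : indicatorLp P (hm s hs) ∈ lpMeas ℝ ℝ m 2 P :=
    mem_lpMeas_indicatorConstLp hm hs _
  refine lpMeas_le_of_generateFrom (by simp) (isClosed_aestronglyMeasurable hm)
    (completion m P).le
    (@MeasurableSpace.generateFrom_measurableSet Ω (completion m P).toMeasurableSpace).symm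
    (@MeasurableSpace.isPiSystem_measurableSet Ω (completion m P).toMeasurableSpace)
    (hmem (@MeasurableSet.univ Ω m)) fun s hs hs' => ?_
  obtain ⟨⟨t, ht, hst⟩, -⟩ := measurableSet_completion.1 hs
  rw [indicatorLp_congr hs' (hm t ht) hst]
  exact hmem ht

lemma completion_le {E : SubSigmaField P} (h : m ≤ E.toMeasurableSpace) :
    (completion m P).toMeasurableSpace ≤ E.toMeasurableSpace := fun s hs => by
  obtain ⟨⟨t, ht, hst⟩, hs'⟩ := measurableSet_completion.1 hs
  exact E.measurableSet_congr (E.le t (h t ht)) hs' hst.symm (h t ht)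

lemma measurableSet_completion_bot [IsProbabilityMeasure P] {s : Set Ω} (hs : MeasurableSet s) :
    MeasurableSet[(completion ⊥ P).toMeasurableSpace] s ↔ P s = 0 ∨ P s = 1 := by
  refine ⟨fun h => ?_, fun h => measurableSet_completion.2 ⟨?_, hs⟩⟩
  · obtain ⟨⟨t, ht, hst⟩, -⟩ := measurableSet_completion.1 h
    rw [measure_congr hst]
    rcases MeasurableSpace.measurableSet_bot_iff.1 ht with rfl | rfl
    · exact .inl measure_empty
    · exact .inr measure_univ
  · rcases h with hPs | hPs
    · exact ⟨∅, @MeasurableSet.empty Ω ⊥, ae_eq_empty.2 hPs⟩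
    · refine ⟨univ, @MeasurableSet.univ Ω ⊥, ?_⟩
      rw [ae_eq_univ, prob_compl_eq_zero_iff hs, hPs]

lemma isTrivial_iff [IsProbabilityMeasure P] {E : SubSigmaField P} :
    E.IsTrivial ↔ E.toMeasurableSpace ≤ (completion ⊥ P).toMeasurableSpace :=
  forall₂_congr fun s hs => (measurableSet_completion_bot (E.le s hs)).symm

end Completion

end SubSigmaField

/-! ### Conditionally nonatomic sub-σ-fields form a `Gδ` set -/

lemma polishSpace_of_isGδ {X : Type*} [TopologicalSpace X] [PolishSpace X] {s : Set X}
    (hs : IsGδ s) : PolishSpace s := by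
  -- `s = ⋂ n, U n` is the diagonal of the product of the Polish spaces `U n`.
  obtain ⟨U, hU, rfl⟩ := hs.eq_iInter_nat
  have hU' (n : ℕ) : PolishSpace (U n) := (hU n).polishSpace
  let diag (x : ↥(⋂ n, U n)) (n : ℕ) : U n := ⟨x.1, mem_iInter.1 x.2 n⟩
  have hdiag : IsEmbedding diag := by
    refine .of_comp (g := fun y => (y 0 : X)) ?_ ?_ IsEmbedding.subtypeVal
    · exact continuous_pi fun n => continuous_subtype_val.subtype_mk _
    · exact continuous_subtype_val.comp (continuous_apply 0)
  have hrange : range diag = ⋂ n, {y | (y n : X) = y 0} := by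
    ext y
    rw [mem_iInter]
    refine ⟨?_, fun h => ⟨⟨y 0, mem_iInter.2 fun n => ?_⟩, ?_⟩⟩
    · rintro ⟨x, rfl⟩ n
      rfl
    · rw [← h n]
      exact (y n).2
    · exact funext fun n => Subtype.ext (h n).symm
  refine IsClosedEmbedding.polishSpace ⟨hdiag, ?_⟩
  rw [hrange]
  exact isClosed_iInter fun n => isClosed_eq
    (continuous_subtype_val.comp (continuous_apply n))
    (continuous_subtype_val.comp (continuous_apply 0))

section Label

variable {Ω : Type*} [MeasurableSpace Ω] [StandardBorelSpace Ω]

/-- The index of the interval of length `1 / n` containing the coordinate, so that the fibres of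
`label n` form a finite measurable partition that becomes arbitrarily fine as `n` grows. -/
noncomputable def label (n : ℕ) (ω : Ω) : Fin (n + 1) :=
  ⟨⌊n * coord Ω ω⌋₊, by
    rw [Nat.lt_succ_iff]
    refine (Nat.floor_le_floor ?_).trans_eq (Nat.floor_natCast n)
    exact mul_le_of_le_one_right n.cast_nonneg (coord_lt_one ω).le⟩

lemma measurable_label (n : ℕ) : Measurable (label n : Ω → Fin (n + 1)) := by
  refine measurable_to_countable' fun j => ?_
  have hfloor : Measurable fun ω : Ω => ⌊n * coord Ω ω⌋₊ :=
    Nat.measurable_floor.comp ((measurable_coord Ω).const_mul _)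
  convert! hfloor (measurableSet_singleton (j : ℕ)) using 1
  ext ω
  exact Fin.ext_iff

lemma mul_abs_coord_sub_lt_one {n : ℕ} {ω ω' : Ω} (h : label n ω = label n ω') :
    n * |coord Ω ω - coord Ω ω'| < 1 := by
  have hfloor : ⌊n * coord Ω ω⌋₊ = ⌊n * coord Ω ω'⌋₊ := Fin.ext_iff.1 h
  have hle (ω : Ω) := Nat.floor_le (mul_nonneg (Nat.cast_nonneg (α := ℝ) n) (coord_pos ω).le)
  have hlt (ω : Ω) := Nat.lt_floor_add_one (n * coord Ω ω)
  rw [← abs_of_nonneg (Nat.cast_nonneg (α := ℝ) n), ← abs_mul, abs_lt]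
  constructor <;> linarith [hle ω, hlt ω, hle ω', hlt ω', congrArg (Nat.cast (R := ℝ)) hfloor]

lemma eventually_label_ne {ω ω' : Ω} (h : ω ≠ ω') : ∀ᶠ n in atTop, label n ω ≠ label n ω' := by
  have hpos : 0 < |coord Ω ω - coord Ω ω'| := abs_pos.2 (sub_ne_zero.2 ((coord_injective Ω).ne h))
  have hlim : Tendsto (fun n : ℕ => n * |coord Ω ω - coord Ω ω'|) atTop atTop :=
    tendsto_natCast_atTop_atTop.atTop_mul_const hpos
  filter_upwards [hlim.eventually_ge_atTop 1] with n hn hlabel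
  exact hn.not_gt (mul_abs_coord_sub_lt_one hlabel)

lemma tendsto_measureReal_fibre_label (ν : Measure Ω) [IsFiniteMeasure ν] (ω : Ω) :
    Tendsto (fun n => ν.real (label n ⁻¹' {label n ω})) atTop (𝓝 (ν.real {ω})) := by
  refine (ENNReal.tendsto_toReal (measure_ne_top ν _)).comp ?_
  refine tendsto_measure_of_tendsto_indicator_of_isFiniteMeasure atTop ν
    (fun n => measurable_label n (measurableSet_singleton _)) fun ω' => ?_
  obtain rfl | h := eq_or_ne ω' ω
  · exact Eventually.of_forall fun n => by simp
  · filter_upwards [eventually_label_ne h] with n hn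
    simp [hn, h]

end Label

section SumSq

variable {Ω κ : Type*} [MeasurableSpace Ω] {φ : Ω → κ} {ν : Measure Ω}

lemma measurable_measureReal_fibre [Countable κ] [MeasurableSpace κ] [MeasurableSingletonClass κ]
    (hφ : Measurable φ) (ν : Measure Ω) : Measurable fun ω => ν.real (φ ⁻¹' {φ ω}) :=
  (measurable_of_countable fun k => ν.real (φ ⁻¹' {k})).comp hφ

variable [Fintype κ]

/-- The sum of the squares of the measures of the cells of a finite partition, which is given by a
labelling `φ` of the points by the cells. -/
noncomputable def sumSq (φ : Ω → κ) (ν : Measure Ω) : ℝ := ∑ k, ν.real (φ ⁻¹' {k}) ^ 2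

/-- The sum of the squares of the measures of the atoms, written as an integral. -/
noncomputable def sumSqAtoms (ν : Measure Ω) : ℝ := ∫ ω, ν.real {ω} ∂ν

lemma sumSqAtoms_nonneg : 0 ≤ sumSqAtoms ν := integral_nonneg fun _ => measureReal_nonneg

lemma sumSq_nonneg : 0 ≤ sumSq φ ν := Finset.sum_nonneg fun _ _ => sq_nonneg _

lemma integrable_measureReal {μ : Measure Ω} [IsFiniteMeasure μ] [IsFiniteMeasure ν]
    {s : Ω → Set Ω} (hs : Measurable fun ω => ν.real (s ω)) :
    Integrable (fun ω => ν.real (s ω)) μ :=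
  .of_bound hs.aestronglyMeasurable (ν.real univ) <| .of_forall fun ω => by
    rw [Real.norm_of_nonneg measureReal_nonneg]
    exact measureReal_mono (subset_univ _)

variable [MeasurableSpace κ] [MeasurableSingletonClass κ]

variable [IsFiniteMeasure ν]

lemma sumSq_eq_integral (hφ : Measurable φ) : sumSq φ ν = ∫ ω, ν.real (φ ⁻¹' {φ ω}) ∂ν := by
  rw [← integral_map (f := fun k => ν.real (φ ⁻¹' {k})) hφ.aemeasurable
    (measurable_of_countable _).aestronglyMeasurable, integral_fintype .of_finite]
  refine Finset.sum_congr rfl fun k _ => ?_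
  rw [map_measureReal_apply hφ (measurableSet_singleton k), smul_eq_mul, sq]

lemma sumSq_le (hφ : Measurable φ) : sumSq φ ν ≤ ν.real univ ^ 2 := by
  rw [sumSq_eq_integral hφ, sq, ← smul_eq_mul, ← integral_const]
  exact integral_mono (integrable_measureReal (measurable_measureReal_fibre hφ ν))
    (integrable_const _) fun ω => measureReal_mono (subset_univ _)

variable [StandardBorelSpace Ω]

lemma measurable_measureReal_singleton : Measurable fun ω => ν.real {ω} :=
  measurable_of_tendsto_metrizable (fun n => measurable_measureReal_fibre (measurable_label n) ν)
    (tendsto_pi_nhds.2 fun ω => tendsto_measureReal_fibre_label ν ω)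

lemma sumSqAtoms_le_sumSq (hφ : Measurable φ) : sumSqAtoms ν ≤ sumSq φ ν := by
  rw [sumSq_eq_integral hφ]
  refine integral_mono (integrable_measureReal measurable_measureReal_singleton)
    (integrable_measureReal (measurable_measureReal_fibre hφ ν)) fun ω => ?_
  exact measureReal_mono (singleton_subset_iff.2 rfl)

lemma tendsto_sumSq_label : Tendsto (fun n => sumSq (label n) ν) atTop (𝓝 (sumSqAtoms ν)) := by
  simp_rw [fun n => sumSq_eq_integral (ν := ν) (measurable_label n)]
  refine tendsto_integral_of_dominated_convergence (fun _ => ν.real univ)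
    (fun n => (measurable_measureReal_fibre (measurable_label n) ν).aestronglyMeasurable)
    (integrable_const _) (fun n => .of_forall fun ω => ?_)
    (.of_forall fun ω => tendsto_measureReal_fibre_label ν ω)
  rw [Real.norm_of_nonneg measureReal_nonneg]
  exact measureReal_mono (subset_univ _)

lemma sumSqAtoms_eq_zero : sumSqAtoms ν = 0 ↔ NullSingletonClass ν := by
  rw [sumSqAtoms, integral_eq_zero_iff_of_nonneg (fun _ => measureReal_nonneg)
    (integrable_measureReal measurable_measureReal_singleton)]
  refine ⟨fun h => ⟨fun ω => ?_⟩, fun h => .of_forall fun ω => by simp [Measure.real]⟩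
  by_contra hω
  have hmem : {ω} ⊆ {ω' | ν.real {ω'} ≠ 0} := by
    simpa [measureReal_eq_zero_iff] using hω
  exact hω (measure_mono_null hmem h)

end SumSq

namespace SubSigmaField

section MeanSumSq

variable {Ω κ : Type*} [MeasurableSpace Ω] [StandardBorelSpace Ω] {P : Measure Ω}
  [IsFiniteMeasure P]

lemma norm_proj_indicatorLp_sq (E : SubSigmaField P) {s : Set Ω} (hs : MeasurableSet s) :
    ‖E.proj (indicatorLp P hs)‖ ^ 2 =
      ∫ ω, (condExpKernel P E.toMeasurableSpace ω).real s ^ 2 ∂P := by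
  have hcondExp : (E.proj (indicatorLp P hs) : Ω → ℝ) =ᵐ[P] P⟦s | E.toMeasurableSpace⟧ :=
    (memLp_indicator_const 2 hs (1 : ℝ) (Or.inr (measure_ne_top P s))).condExpL2_ae_eq_condExp
      E.le
  rw [← real_inner_self_eq_norm_sq, L2.inner_def]
  refine integral_congr_ae ?_
  filter_upwards [hcondExp, condExpKernel_ae_eq_condExp E.le (μ := P) hs] with ω hproj hkernel
  rw [hproj, hkernel, real_inner_self_eq_norm_sq, Real.norm_eq_abs, sq_abs]

lemma measurable_condExpKernel_real (E : SubSigmaField P) {s : Set Ω} (hs : MeasurableSet s) :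
    Measurable fun ω => (condExpKernel P E.toMeasurableSpace ω).real s :=
  ((measurable_condExpKernel hs).mono E.le le_rfl).ennreal_toReal

omit [StandardBorelSpace Ω] in
lemma integrable_of_mem_Icc {f : Ω → ℝ} (hf : Measurable f) (h : ∀ ω, f ω ∈ Icc (0 : ℝ) 1) :
    Integrable f P :=
  .of_bound hf.aestronglyMeasurable 1 <| .of_forall fun ω => by
    rw [Real.norm_of_nonneg (h ω).1]
    exact (h ω).2

variable [Fintype κ] [MeasurableSpace κ] [MeasurableSingletonClass κ] {φ : Ω → κ}

/-- The mean of the sum of the squares of the conditional measures of the cells of a finite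
partition. It is written in terms of orthogonal projections to make its continuity in the
sub-σ-field evident. -/
noncomputable def meanSumSq (hφ : Measurable φ) (E : SubSigmaField P) : ℝ :=
  ∑ k, ‖E.proj (indicatorLp P (hφ (measurableSet_singleton k)))‖ ^ 2

omit [StandardBorelSpace Ω] in
lemma continuous_meanSumSq (hφ : Measurable φ) :
    Continuous (meanSumSq hφ : SubSigmaField P → ℝ) :=
  continuous_finsetSum _ fun _ _ => (continuous_norm_proj _).pow 2

lemma measurable_sumSq_condExpKernel (hφ : Measurable φ) (E : SubSigmaField P) :
    Measurable fun ω => sumSq φ (condExpKernel P E.toMeasurableSpace ω) :=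
  Finset.measurable_fun_sum _ fun _ _ =>
    (E.measurable_condExpKernel_real (hφ (measurableSet_singleton _))).pow_const 2

lemma sumSq_condExpKernel_mem_Icc (hφ : Measurable φ) (E : SubSigmaField P) (ω : Ω) :
    sumSq φ (condExpKernel P E.toMeasurableSpace ω) ∈ Icc (0 : ℝ) 1 :=
  ⟨sumSq_nonneg, (sumSq_le hφ).trans_eq (by simp)⟩

lemma integrable_sumSq_condExpKernel (hφ : Measurable φ) (E : SubSigmaField P) :
    Integrable (fun ω => sumSq φ (condExpKernel P E.toMeasurableSpace ω)) P :=
  integrable_of_mem_Icc (measurable_sumSq_condExpKernel hφ E) (sumSq_condExpKernel_mem_Icc hφ E)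

lemma meanSumSq_eq_integral (hφ : Measurable φ) (E : SubSigmaField P) :
    meanSumSq hφ E = ∫ ω, sumSq φ (condExpKernel P E.toMeasurableSpace ω) ∂P := by
  unfold sumSq
  rw [integral_finsetSum _ fun k _ => integrable_of_mem_Icc
    ((E.measurable_condExpKernel_real (hφ (measurableSet_singleton k))).pow_const 2)
    fun ω => ⟨sq_nonneg _, pow_le_one₀ measureReal_nonneg measureReal_le_one⟩]
  exact Finset.sum_congr rfl fun k _ => E.norm_proj_indicatorLp_sq _

lemma integrable_sumSqAtoms_condExpKernel (E : SubSigmaField P) :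
    Integrable (fun ω => sumSqAtoms (condExpKernel P E.toMeasurableSpace ω)) P := by
  refine integrable_of_mem_Icc ?_ fun ω => ⟨sumSqAtoms_nonneg,
    (sumSqAtoms_le_sumSq (measurable_label 0)).trans
      (sumSq_condExpKernel_mem_Icc (measurable_label 0) E ω).2⟩
  exact measurable_of_tendsto_metrizable
    (fun n => measurable_sumSq_condExpKernel (measurable_label n) E)
    (tendsto_pi_nhds.2 fun ω => tendsto_sumSq_label)

lemma isCondNonatomic_iff_integral {E : SubSigmaField P} : E.IsCondNonatomic ↔
    ∫ ω, sumSqAtoms (condExpKernel P E.toMeasurableSpace ω) ∂P = 0 := by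
  rw [integral_eq_zero_iff_of_nonneg (fun _ => sumSqAtoms_nonneg)
    E.integrable_sumSqAtoms_condExpKernel]
  exact eventually_congr (.of_forall fun ω => sumSqAtoms_eq_zero.symm)

lemma integral_sumSqAtoms_condExpKernel_le_meanSumSq (hφ : Measurable φ) (E : SubSigmaField P) :
    ∫ ω, sumSqAtoms (condExpKernel P E.toMeasurableSpace ω) ∂P ≤ meanSumSq hφ E := by
  rw [meanSumSq_eq_integral]
  exact integral_mono E.integrable_sumSqAtoms_condExpKernel
    (E.integrable_sumSq_condExpKernel hφ) fun ω => sumSqAtoms_le_sumSq hφ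

lemma tendsto_meanSumSq_label (E : SubSigmaField P) :
    Tendsto (fun n => meanSumSq (measurable_label n) E) atTop
      (𝓝 (∫ ω, sumSqAtoms (condExpKernel P E.toMeasurableSpace ω) ∂P)) := by
  simp_rw [fun n => meanSumSq_eq_integral (measurable_label n) E]
  refine tendsto_integral_of_dominated_convergence (fun _ => 1)
    (fun n => (measurable_sumSq_condExpKernel (measurable_label n) E).aestronglyMeasurable)
    (integrable_const 1) (fun n => .of_forall fun ω => ?_) (.of_forall fun ω => tendsto_sumSq_label)
  rw [Real.norm_of_nonneg sumSq_nonneg]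
  exact (sumSq_condExpKernel_mem_Icc (measurable_label n) E ω).2

lemma IsCondNonatomic.tendsto_meanSumSq_label {E : SubSigmaField P} (h : E.IsCondNonatomic) :
    Tendsto (fun n => meanSumSq (measurable_label n) E) atTop (𝓝 0) :=
  isCondNonatomic_iff_integral.1 h ▸ E.tendsto_meanSumSq_label

lemma isCondNonatomic_of_tendsto {E : SubSigmaField P} {u : ℕ → ℝ} (hu : Tendsto u atTop (𝓝 0))
    (h : ∀ n, ∫ ω, sumSqAtoms (condExpKernel P E.toMeasurableSpace ω) ∂P ≤ u n) :
    E.IsCondNonatomic :=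
  isCondNonatomic_iff_integral.2
    (le_antisymm (ge_of_tendsto' hu h) (integral_nonneg fun _ => sumSqAtoms_nonneg))

theorem isGδ_setOf_isCondNonatomic : IsGδ {E : SubSigmaField P | E.IsCondNonatomic} := by
  have heq : {E : SubSigmaField P | E.IsCondNonatomic} =
      ⋂ k : ℕ, ⋃ n, {E | meanSumSq (measurable_label n) E < 1 / ((k : ℝ) + 1)} := by
    ext E
    simp only [mem_iInter, mem_iUnion, mem_ofPred_eq]
    refine ⟨fun h k => ?_, fun h => ?_⟩
    · exact (h.tendsto_meanSumSq_label.eventually_lt_const Nat.one_div_pos_of_nat).exists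
    · choose n hn using h
      exact isCondNonatomic_of_tendsto tendsto_one_div_add_atTop_nhds_zero_nat fun k =>
        (integral_sumSqAtoms_condExpKernel_le_meanSumSq _ E).trans (hn k).le
  rw [heq]
  exact .iInter_of_isOpen fun k => isOpen_iUnion fun n =>
    isOpen_lt (continuous_meanSumSq _) continuous_const

end MeanSumSq

end SubSigmaField

/-! ### The Polish space of filtrations -/

section FiltrationSpace

variable {Ω : Type*} [mΩ : MeasurableSpace Ω] [StandardBorelSpace Ω] {P : Measure Ω}

instance [IsFiniteMeasure P] : PolishSpace (CondNonatomicField P) :=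
  polishSpace_of_isGδ SubSigmaField.isGδ_setOf_isCondNonatomic

lemma polishSpace_continuousMap {T Y : Type*} [TopologicalSpace T] [CompactSpace T]
    [SecondCountableTopology T] [T2Space T] [TopologicalSpace Y] [PolishSpace Y] :
    PolishSpace C(T, Y) := by
  let := TopologicalSpace.upgradeIsCompletelyMetrizable Y
  infer_instance

variable [IsProbabilityMeasure P]

lemma isClosed_setOf_isFiltration (T : Set ℝ≥0∞) :
    IsClosed {x : C(T, CondNonatomicField P) | IsFiltration x} := by
  have hcont (t : T) (f : Lp ℝ 2 P) :
      Continuous fun x : C(T, CondNonatomicField P) => (x t).1.infDist f :=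
    (SubSigmaField.continuous_infDist f).comp
      (continuous_subtype_val.comp (continuous_eval_const t))
  have hmono (s t : T) : IsClosed {x : C(T, CondNonatomicField P) |
      (x s).1.toMeasurableSpace ≤ (x t).1.toMeasurableSpace} := by
    simp_rw [SubSigmaField.le_iff_infDist_le, ofPred_forall]
    exact isClosed_iInter fun f => isClosed_le (hcont t f) (hcont s f)
  have htrivial (t : T) : IsClosed {x : C(T, CondNonatomicField P) | (x t).1.IsTrivial} := by
    simp_rw [SubSigmaField.isTrivial_iff, SubSigmaField.le_iff_infDist_le, ofPred_forall]
    exact isClosed_iInter fun f => isClosed_le continuous_const (hcont t f)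
  have hiff (x : C(T, CondNonatomicField P)) : IsFiltration x ↔
      (∀ s t : T, s ≤ t → (x s).1.toMeasurableSpace ≤ (x t).1.toMeasurableSpace) ∧
        ∀ t : T, (∀ s : T, t ≤ s) → (x t).1.IsTrivial :=
    ⟨fun h => ⟨h.mono, h.trivial_of_least⟩, fun h => ⟨h.1, h.2⟩⟩
  simp_rw [hiff, ofPred_and, ofPred_forall]
  exact (isClosed_iInter fun s => isClosed_iInter fun t => isClosed_iInter fun _ => hmono s t).inter
    (isClosed_iInter fun t => isClosed_iInter fun _ => htrivial t)

lemma polishSpace_filtrationSpace {T : Set ℝ≥0∞} (hT : IsCompact T) :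
    PolishSpace (FiltrationSpace P T) := by
  have : CompactSpace T := isCompact_iff_compactSpace.1 hT
  have : PolishSpace C(T, CondNonatomicField P) := polishSpace_continuousMap
  exact (isClosed_setOf_isFiltration T).polishSpace

end FiltrationSpace

/-! ### Koopman operators -/

section Koopman

variable {Ω Ω' Ω'' : Type*} [MeasurableSpace Ω] [MeasurableSpace Ω'] [MeasurableSpace Ω'']
  {P : Measure Ω} {P' : Measure Ω'} {P'' : Measure Ω''}

/-- The Koopman operator of a measure preserving map `T`: the isometry `f ↦ f ∘ T` of `L²` spaces.
It is contravariant in `T`. -/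
noncomputable abbrev koopman {T : Ω → Ω'} (hT : MeasurePreserving T P P') :
    Lp ℝ 2 P' →ₗᵢ[ℝ] Lp ℝ 2 P :=
  Lp.compMeasurePreservingₗᵢ ℝ T hT

lemma coeFn_koopman {T : Ω → Ω'} (hT : MeasurePreserving T P P') (f : Lp ℝ 2 P') :
    koopman hT f =ᵐ[P] f ∘ T :=
  Lp.coeFn_compMeasurePreserving f hT

lemma koopman_comp {S : Ω' → Ω''} {T : Ω → Ω'} (hS : MeasurePreserving S P' P'')
    (hT : MeasurePreserving T P P') (f : Lp ℝ 2 P'') :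
    koopman (hS.comp hT) f = koopman hT (koopman hS f) :=
  Lp.compMeasurePreserving_comp_apply f hS hT

lemma koopman_congr {S T : Ω → Ω'} (hS : MeasurePreserving S P P') (hT : MeasurePreserving T P P')
    (h : S =ᵐ[P] T) : koopman hS = koopman hT := by
  ext1 f
  ext1
  grw [coeFn_koopman, coeFn_koopman]
  exact h.fun_comp f

lemma koopman_abs {T : Ω → Ω'} (hT : MeasurePreserving T P P') (f : Lp ℝ 2 P') :
    koopman hT |f| = |koopman hT f| := by
  ext1
  filter_upwards [coeFn_koopman hT |f|, coeFn_koopman hT f, Lp.coeFn_abs (koopman hT f),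
    hT.quasiMeasurePreserving.ae (Lp.coeFn_abs f)] with ω habs hf habs' hω
  rw [habs, habs', hf, Function.comp_apply, hω, Function.comp_apply]

lemma koopman_indicatorLp [IsFiniteMeasure P] [IsFiniteMeasure P'] {T : Ω → Ω'}
    (hT : MeasurePreserving T P P') {s : Set Ω'} (hs : MeasurableSet s) :
    koopman hT (indicatorLp P' hs) = indicatorLp P (hT.measurable hs) :=
  rfl

lemma dist_indicatorLp_sq [IsFiniteMeasure P] {s t : Set Ω} (hs : MeasurableSet s)
    (ht : MeasurableSet t) :
    dist (indicatorLp P hs : Lp ℝ 2 P) (indicatorLp P ht) ^ 2 = P.real (s ∆ t) := by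
  rw [indicatorLp, indicatorLp, dist_indicatorConstLp_eq_norm]
  exact norm_indicatorLp_sq (hs.symmDiff ht)

section LimitSpace

variable {ι : Type*} {l : Filter ι} {T : ι → Ω → Ω'} {hT : ∀ i, MeasurePreserving (T i) P P'}
  {S : Ω → Ω'} {hS : MeasurePreserving S P P'}

/-- The functions on which the Koopman operators of the maps `T i` converge to that of `S`. -/
noncomputable def koopmanLimitSpace (l : Filter ι) (hT : ∀ i, MeasurePreserving (T i) P P')
    (hS : MeasurePreserving S P P') : Submodule ℝ (Lp ℝ 2 P') :=
  tendstoSubmodule (fun i => (koopman (hT i)).toLinearMap) l (koopman hS).toLinearMap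

lemma isClosed_koopmanLimitSpace : IsClosed (koopmanLimitSpace l hT hS : Set (Lp ℝ 2 P')) :=
  isClosed_setOf_tendsto (fun i => (koopman (hT i)).lipschitz) (koopman hS).lipschitz

lemma abs_mem_koopmanLimitSpace (f : Lp ℝ 2 P') (hf : f ∈ koopmanLimitSpace l hT hS) :
    |f| ∈ koopmanLimitSpace l hT hS := by
  change Tendsto (fun i => koopman (hT i) |f|) l (𝓝 (koopman hS |f|))
  simp_rw [koopman_abs]
  exact hf.sup_nhds hf.neg

variable [IsFiniteMeasure P']

lemma indicatorLp_univ_mem_koopmanLimitSpace :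
    indicatorLp P' MeasurableSet.univ ∈ koopmanLimitSpace l hT hS :=
  tendsto_const_nhds

lemma tendsto_koopman_of_forall_indicatorLp
    (h : ∀ s, ∀ hs : MeasurableSet s, Tendsto (fun i => koopman (hT i) (indicatorLp P' hs)) l
      (𝓝 (koopman hS (indicatorLp P' hs)))) (f : Lp ℝ 2 P') :
    Tendsto (fun i => koopman (hT i) f) l (𝓝 (koopman hS f)) := by
  have htop : koopmanLimitSpace l hT hS = ⊤ :=
    eq_top_of_generateFrom (by simp) isClosed_koopmanLimitSpace
      MeasurableSpace.generateFrom_measurableSet.symm MeasurableSpace.isPiSystem_measurableSet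
      indicatorLp_univ_mem_koopmanLimitSpace fun s _ hs => h s hs
  exact htop.ge (Submodule.mem_top (x := f))

theorem tendsto_koopman_of_coordLp [StandardBorelSpace Ω']
    (h : Tendsto (fun i => koopman (hT i) (coordLp P')) l (𝓝 (koopman hS (coordLp P'))))
    (f : Lp ℝ 2 P') : Tendsto (fun i => koopman (hT i) f) l (𝓝 (koopman hS f)) := by
  have htop : koopmanLimitSpace l hT hS = ⊤ :=
    eq_top_of_coordLp_mem P' (by simp) isClosed_koopmanLimitSpace abs_mem_koopmanLimitSpace
      indicatorLp_univ_mem_koopmanLimitSpace h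
  exact htop.ge (Submodule.mem_top (x := f))

end LimitSpace

section Limit

variable [IsProbabilityMeasure P] {ι : Type*} {l : Filter ι} [NeBot l] [l.IsCountablyGenerated]
  {T : ι → Ω → Ω'} {hT : ∀ i, MeasurePreserving (T i) P P'}

lemma map_eq_of_tendsto_koopman {f : Lp ℝ 2 P'} {η : Lp ℝ 2 P}
    (h : Tendsto (fun i => koopman (hT i) f) l (𝓝 η)) : P.map η = P'.map f := by
  have hlaw i : P.map (koopman (hT i) f) = P'.map f := by
    rw [Measure.map_congr (coeFn_koopman (hT i) f),
      ← Measure.map_map (Lp.stronglyMeasurable f).measurable (hT i).measurable, (hT i).map_eq]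
  have haem (g : Lp ℝ 2 P) : AEMeasurable g P := (Lp.stronglyMeasurable g).aemeasurable
  obtain ⟨i⟩ := l.nonempty_of_neBot
  refine (tendstoInDistribution_unique _
    ((tendstoInMeasure_of_tendsto_Lp h).tendstoInDistribution fun i => haem _)
    (tendstoInDistribution_of_identDistrib i
      (fun j => ⟨haem _, haem _, (hlaw i).trans (hlaw j).symm⟩)
      (.refl (haem (koopman (hT i) f))))).trans (hlaw i)

variable [StandardBorelSpace Ω']

lemma exists_koopman_coordLp_eq [IsFiniteMeasure P'] {η : Lp ℝ 2 P}
    (hη : P.map η = P'.map (coord Ω')) :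
    ∃ (S : Ω → Ω') (hS : MeasurePreserving S P P'), koopman hS (coordLp P') = η := by
  have hηm : Measurable η := (Lp.stronglyMeasurable η).measurable
  have hmem : ∀ᵐ ω ∂P, η ω ∈ range (coord Ω') := by
    refine ae_of_ae_map hηm.aemeasurable (hη ▸ ?_)
    exact (ae_map_iff (measurable_coord Ω').aemeasurable
      (measurableEmbedding_coord Ω').measurableSet_range).2 (.of_forall fun ω => mem_range_self ω)
  obtain ⟨ω₀, ω', -⟩ := hmem.exists
  obtain ⟨r, hr, hrc⟩ := (measurableEmbedding_coord Ω').exists_measurable_extend measurable_id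
    fun _ => ⟨ω'⟩
  have hS : MeasurePreserving (r ∘ η) P P' := by
    refine ⟨hr.comp hηm, ?_⟩
    rw [← Measure.map_map hr hηm, hη, Measure.map_map hr (measurable_coord Ω'), hrc,
      Measure.map_id]
  refine ⟨r ∘ η, hS, ?_⟩
  ext1
  filter_upwards [coeFn_koopman hS (coordLp P'),
    hS.quasiMeasurePreserving.ae (coeFn_coordLp P'), hmem] with ω hSω hcoord ⟨ω'', hω''⟩
  rw [hSω, Function.comp_apply, hcoord, Function.comp_apply, ← hω'']
  exact congrArg _ (congrFun hrc ω'')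

theorem exists_koopman_eq_of_tendsto [IsFiniteMeasure P'] {η : Lp ℝ 2 P}
    (h : Tendsto (fun i => koopman (hT i) (coordLp P')) l (𝓝 η)) :
    ∃ (S : Ω → Ω') (hS : MeasurePreserving S P P'), koopman hS (coordLp P') = η :=
  exists_koopman_coordLp_eq
    ((map_eq_of_tendsto_koopman h).trans (Measure.map_congr (coeFn_coordLp P')))

end Limit

end Koopman

/-! ### The automorphism group is Polish -/

section AutTopologicalGroup

variable {Ω : Type*} [MeasurableSpace Ω] {P : Measure Ω}

lemma imageSet_mul (g h : mpPerm P) (s : MeasuredSets P) :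
    imageSet P (g * h) s = imageSet P g (imageSet P h s) :=
  Subtype.ext (image_comp (g : Equiv.Perm Ω) (h : Equiv.Perm Ω) s.1)

lemma imageSet_imageSet_inv (g : mpPerm P) (s : MeasuredSets P) :
    imageSet P g (imageSet P g⁻¹ s) = s := by
  rw [← imageSet_mul, mul_inv_cancel]
  exact Subtype.ext (image_id s.1)

variable [IsFiniteMeasure P]

lemma isometry_imageSet (g : mpPerm P) : Isometry (imageSet P g) :=
  .of_dist_eq fun s t => by
    have himage : ((imageSet P g s : Set Ω) ∆ (imageSet P g t : Set Ω)) =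
        (g : Equiv.Perm Ω).symm ⁻¹' ((s : Set Ω) ∆ (t : Set Ω)) := by
      change ((g : Equiv.Perm Ω) '' s.1) ∆ ((g : Equiv.Perm Ω) '' t.1) = _
      rw [Equiv.image_eq_preimage_symm, Equiv.image_eq_preimage_symm]
      rfl
    rw [MeasuredSets.dist_def, MeasuredSets.dist_def, himage]
    exact g.2.2.measureReal_preimage (s.2.symmDiff t.2).nullMeasurableSet

lemma tendsto_mpPerm_iff {ι : Type*} {l : Filter ι} {u : ι → mpPerm P} {g : mpPerm P} :
    Tendsto u l (𝓝 g) ↔ ∀ s, Tendsto (fun i => imageSet P (u i) s) l (𝓝 (imageSet P g s)) := by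
  have hind : IsInducing fun (e : mpPerm P) (s : MeasuredSets P) => imageSet P e s := ⟨rfl⟩
  exact hind.tendsto_nhds_iff.trans tendsto_pi_nhds

lemma tendsto_imageSet (g : mpPerm P) (s : MeasuredSets P) :
    Tendsto (fun e => imageSet P e s) (𝓝 g) (𝓝 (imageSet P g s)) :=
  tendsto_mpPerm_iff.1 tendsto_id s

instance : IsTopologicalGroup (mpPerm P) where
  continuous_mul := by
    rw [continuous_iff_continuousAt]
    rintro ⟨g, h⟩
    refine tendsto_mpPerm_iff.2 fun s => tendsto_iff_dist_tendsto_zero.2 ?_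
    have hlim : Tendsto (fun p : mpPerm P × mpPerm P =>
        dist (imageSet P p.2 s) (imageSet P h s) +
          dist (imageSet P p.1 (imageSet P h s)) (imageSet P g (imageSet P h s)))
        (𝓝 (g, h)) (𝓝 0) := by
      rw [nhds_prod_eq, ← add_zero (0 : ℝ)]
      exact ((tendsto_iff_dist_tendsto_zero.1 (tendsto_imageSet h s)).comp tendsto_snd).add
        ((tendsto_iff_dist_tendsto_zero.1 (tendsto_imageSet g _)).comp tendsto_fst)
    refine squeeze_zero (fun _ => dist_nonneg) (fun p => ?_) hlim
    rw [imageSet_mul, imageSet_mul, ← (isometry_imageSet p.1).dist_eq (imageSet P p.2 s)]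
    exact dist_triangle _ _ _
  continuous_inv := by
    rw [continuous_iff_continuousAt]
    intro g
    refine tendsto_mpPerm_iff.2 fun s => tendsto_iff_dist_tendsto_zero.2 ?_
    refine (tendsto_iff_dist_tendsto_zero.1 (tendsto_imageSet g (imageSet P g⁻¹ s))).congr
      fun e => ?_
    rw [← (isometry_imageSet e).dist_eq (imageSet P e⁻¹ s), imageSet_imageSet_inv,
      imageSet_imageSet_inv, dist_comm]

end AutTopologicalGroup

section KoopmanPerm

variable {Ω : Type*} [MeasurableSpace Ω] {P : Measure Ω}

/-- The Koopman operator `f ↦ f ∘ e` of an invertible measure preserving map `e`. -/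
noncomputable abbrev koopmanPerm (e : mpPerm P) : Lp ℝ 2 P →ₗᵢ[ℝ] Lp ℝ 2 P := koopman e.2.1

lemma koopmanPerm_koopmanPerm_inv (e : mpPerm P) (f : Lp ℝ 2 P) :
    koopmanPerm e (koopmanPerm e⁻¹ f) = f := by
  rw [← koopman_comp, koopman_congr _ (.id P)]
  · exact Lp.compMeasurePreserving_id_apply f
  · exact .of_forall (e : Equiv.Perm Ω).symm_apply_apply

lemma koopman_eq_of_tendsto_koopmanPerm_inv {l : Filter (mpPerm P)} [NeBot l] {S : Ω → Ω}
    {hS : MeasurePreserving S P P} {f η : Lp ℝ 2 P}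
    (h : ∀ f, Tendsto (fun e => koopmanPerm e f) l (𝓝 (koopman hS f)))
    (hη : Tendsto (fun e => koopmanPerm e⁻¹ f) l (𝓝 η)) : koopman hS η = f := by
  refine tendsto_nhds_unique (h η) (tendsto_iff_dist_tendsto_zero.2 ?_)
  refine (tendsto_iff_dist_tendsto_zero.1 hη).congr fun e => ?_
  conv_rhs => rw [← koopmanPerm_koopmanPerm_inv e f]
  rw [(koopmanPerm e).isometry.dist_eq, dist_comm]

variable [IsFiniteMeasure P]

lemma dist_imageSet_inv (e g : mpPerm P) (s : MeasuredSets P) :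
    dist (imageSet P e⁻¹ s) (imageSet P g⁻¹ s) =
      dist (koopmanPerm e (indicatorLp P s.2)) (koopmanPerm g (indicatorLp P s.2)) ^ 2 := by
  have himage (e : mpPerm P) : (imageSet P e⁻¹ s : Set Ω) = (e : Equiv.Perm Ω) ⁻¹' s :=
    Equiv.image_eq_preimage_symm _ _
  rw [koopman_indicatorLp, koopman_indicatorLp, dist_indicatorLp_sq, MeasuredSets.dist_def, himage,
    himage]
  rfl

theorem tendsto_mpPerm_iff_koopmanPerm {ι : Type*} {l : Filter ι} {u : ι → mpPerm P}
    {g : mpPerm P} :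
    Tendsto u l (𝓝 g) ↔
      ∀ f, Tendsto (fun i => koopmanPerm (u i) f) l (𝓝 (koopmanPerm g f)) := by
  rw [← tendsto_inv_iff, tendsto_mpPerm_iff]
  simp_rw [tendsto_iff_dist_tendsto_zero (f := fun _ => imageSet P _ _), dist_imageSet_inv]
  constructor
  · intro h
    refine tendsto_koopman_of_forall_indicatorLp fun s hs => tendsto_iff_dist_tendsto_zero.2 ?_
    simpa [Real.sqrt_sq dist_nonneg] using (h ⟨s, hs⟩).sqrt
  · intro h s
    simpa using (tendsto_iff_dist_tendsto_zero.1 (h (indicatorLp P s.2))).pow 2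

lemma continuous_koopmanPerm (f : Lp ℝ 2 P) : Continuous fun e : mpPerm P => koopmanPerm e f :=
  continuous_iff_continuousAt.2 fun _ => tendsto_mpPerm_iff_koopmanPerm.1 tendsto_id f

end KoopmanPerm

section CoordPair

variable {Ω : Type*} [MeasurableSpace Ω] [StandardBorelSpace Ω] {P : Measure Ω}
  [IsFiniteMeasure P]

/-- The functions `coord ∘ e` and `coord ∘ e⁻¹`. The first alone determines `e` modulo null sets,
but its possible limits also come from noninvertible maps; the pair has closed range. -/
noncomputable def coordPair (e : mpPerm P) : Lp ℝ 2 P × Lp ℝ 2 P :=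
  (koopmanPerm e (coordLp P), koopmanPerm e⁻¹ (coordLp P))

lemma continuous_coordPair : Continuous (coordPair : mpPerm P → _) :=
  (continuous_koopmanPerm _).prodMk ((continuous_koopmanPerm _).comp continuous_inv)

lemma isInducing_coordPair : IsInducing (coordPair : mpPerm P → _) := by
  refine isInducing_iff_nhds.2 fun e => le_antisymm (continuous_coordPair.tendsto e).le_comap ?_
  rw [← tendsto_id', tendsto_mpPerm_iff_koopmanPerm]
  exact tendsto_koopman_of_coordLp ((continuous_fst.tendsto (coordPair e)).comp tendsto_comap)

omit [StandardBorelSpace Ω] [IsFiniteMeasure P] in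
lemma mk_eq_mk_iff {e e' : mpPerm P} :
    (QuotientGroup.mk e : Aut P) = QuotientGroup.mk e' ↔
      (e : Equiv.Perm Ω) =ᵐ[P] (e' : Equiv.Perm Ω) := by
  rw [QuotientGroup.eq]
  change (∀ᵐ ω ∂P, (e : Equiv.Perm Ω).symm ((e' : Equiv.Perm Ω) ω) = ω) ↔ _
  refine eventually_congr (.of_forall fun ω => ?_)
  rw [Equiv.symm_apply_eq, eq_comm]

lemma ae_eq_of_koopman_coordLp_eq {Ω' : Type*} [MeasurableSpace Ω'] {P' : Measure Ω'}
    {S T : Ω' → Ω} {hS : MeasurePreserving S P' P} {hT : MeasurePreserving T P' P}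
    (h : koopman hS (coordLp P) = koopman hT (coordLp P)) : S =ᵐ[P'] T := by
  have hcoord {R : Ω' → Ω} (hR : MeasurePreserving R P' P) :
      koopman hR (coordLp P) =ᵐ[P'] coord Ω ∘ R :=
    (coeFn_koopman hR _).trans (hR.quasiMeasurePreserving.ae_eq_comp (coeFn_coordLp P))
  filter_upwards [hcoord hS, hcoord hT] with ω hSω hTω
  exact coord_injective Ω (hSω.symm.trans (h ▸ hTω))

lemma coordPair_eq_iff {e e' : mpPerm P} :
    coordPair e = coordPair e' ↔ (QuotientGroup.mk e : Aut P) = QuotientGroup.mk e' := by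
  refine ⟨fun h => mk_eq_mk_iff.2 (ae_eq_of_koopman_coordLp_eq (congrArg Prod.fst h)),
    fun h => ?_⟩
  have hinv : (QuotientGroup.mk e⁻¹ : Aut P) = QuotientGroup.mk e'⁻¹ := by
    rw [QuotientGroup.mk_inv, QuotientGroup.mk_inv, h]
  rw [coordPair, coordPair, koopmanPerm, koopman_congr _ e'.2.1 (mk_eq_mk_iff.1 h), koopmanPerm,
    koopman_congr _ (e'⁻¹).2.1 (mk_eq_mk_iff.1 hinv)]

/-- `coordPair` as a map on the group of automorphisms modulo null sets, where it is an
embedding. -/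
noncomputable def autCoordPair : Aut P → Lp ℝ 2 P × Lp ℝ 2 P :=
  Quotient.lift coordPair fun _ _ h => coordPair_eq_iff.2 (Quotient.sound h)

lemma isEmbedding_autCoordPair : IsEmbedding (autCoordPair : Aut P → _) := by
  refine ⟨⟨le_antisymm ?_ fun U hU => ?_⟩, ?_⟩
  · exact (continuous_coordPair.quotient_lift _).le_induced
  · obtain ⟨V, hV, hVU⟩ :=
      isInducing_coordPair.isOpen_iff.1 (hU.preimage QuotientGroup.continuous_mk)
    refine isOpen_induced_iff.2 ⟨V, hV, ?_⟩
    ext g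
    induction g using QuotientGroup.induction_on with
    | H e => exact Set.ext_iff.1 hVU e
  · rintro ⟨e⟩ ⟨e'⟩ h
    exact coordPair_eq_iff.1 h

lemma range_autCoordPair : range (autCoordPair : Aut P → _) = range coordPair :=
  range_quot_lift _

end CoordPair

section ClosedRange

variable {Ω : Type*} [MeasurableSpace Ω] [StandardBorelSpace Ω] {P : Measure Ω}
  [IsProbabilityMeasure P] [NullSingletonClass P]

lemma exists_koopmanPerm_eq_of_koopman_eq_coordLp {S : Ω → Ω} {hS : MeasurePreserving S P P}
    {ζ : Lp ℝ 2 P} (h : koopman hS ζ = coordLp P) : ∃ g : mpPerm P, koopmanPerm g = koopman hS := by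
  let A : Set Ω := {ω | coord Ω ω = ζ (S ω)}
  have hA : MeasurableSet A := measurableSet_eq_fun (measurable_coord Ω)
    ((Lp.stronglyMeasurable ζ).measurable.comp hS.measurable)
  have hPA : ∀ᵐ ω ∂P, ω ∈ A := (coeFn_coordLp P).symm.trans (h ▸ coeFn_koopman hS ζ)
  have hinj : InjOn S A := fun ω (hω : _ = _) ω' (hω' : _ = _) hSω =>
    coord_injective Ω (by rw [hω, hω', hSω])
  obtain ⟨e, he, heS⟩ := exists_measurableEquiv_ae_eq hS hA hPA hinj
  exact ⟨⟨e.toEquiv, he, he.symm e⟩, koopman_congr _ _ heS⟩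

lemma isClosed_range_coordPair : IsClosed (range (coordPair : mpPerm P → _)) := by
  refine isClosed_of_closure_subset ?_
  rintro ⟨η, ζ⟩ hclosure
  let l : Filter (mpPerm P) := comap coordPair (𝓝 (η, ζ))
  have hl : NeBot l := comap_neBot_iff.2 fun t ht => by
    obtain ⟨_, hz, e, rfl⟩ := mem_closure_iff_nhds.1 hclosure t ht
    exact ⟨e, hz⟩
  have hη : Tendsto (fun e : mpPerm P => koopmanPerm e (coordLp P)) l (𝓝 η) :=
    (continuous_fst.tendsto (η, ζ)).comp tendsto_comap
  have hζ : Tendsto (fun e : mpPerm P => koopmanPerm e⁻¹ (coordLp P)) l (𝓝 ζ) :=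
    (continuous_snd.tendsto (η, ζ)).comp tendsto_comap
  obtain ⟨S, hS, rfl⟩ := exists_koopman_eq_of_tendsto hη
  have hSζ : koopman hS ζ = coordLp P :=
    koopman_eq_of_tendsto_koopmanPerm_inv (tendsto_koopman_of_coordLp hη) hζ
  obtain ⟨g, hg⟩ := exists_koopmanPerm_eq_of_koopman_eq_coordLp hSζ
  refine ⟨g, Prod.ext (congrArg (· (coordLp P)) hg) ((koopmanPerm g).injective ?_)⟩
  exact (koopmanPerm_koopmanPerm_inv g _).trans (hSζ.symm.trans (congrArg (· ζ) hg.symm))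

instance : PolishSpace (Aut P) :=
  IsClosedEmbedding.polishSpace (f := autCoordPair)
    ⟨isEmbedding_autCoordPair, range_autCoordPair (P := P) ▸ isClosed_range_coordPair⟩

end ClosedRange

/-! ### Continuity of the action -/

section Action

variable {Ω : Type*} [MeasurableSpace Ω] {P : Measure Ω}

lemma infDist_smul_field (e : mpPerm P) (E : SubSigmaField P) (f : Lp ℝ 2 P) :
    (e • E).infDist f = E.infDist (koopmanPerm e f) := by
  have h := Metric.infDist_image (koopmanPerm e).isometry (x := f)
    (t := ((e • E).toClosedSubspace : Set (Lp ℝ 2 P)))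
  exact (h.symm.trans (congrArg _ (SubSigmaField.image_toClosedSubspace_smul e E)))

lemma continuous_infDist_uncurry :
    Continuous fun p : Lp ℝ 2 P × SubSigmaField P => p.2.infDist p.1 :=
  continuous_prod_of_continuous_lipschitzWith _ 1 SubSigmaField.continuous_infDist
    fun E => E.lipschitzWith_infDist

variable [IsFiniteMeasure P]

lemma continuous_infDist_smul (f : Lp ℝ 2 P) :
    Continuous fun p : mpPerm P × SubSigmaField P => (p.1 • p.2).infDist f := by
  have h : Continuous fun p : mpPerm P × SubSigmaField P => (koopmanPerm p.1 f, p.2) :=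
    ((continuous_koopmanPerm f).comp continuous_fst).prodMk continuous_snd
  exact (continuous_infDist_uncurry.comp h).congr fun p => (infDist_smul_field p.1 p.2 f).symm

lemma continuous_mpPerm_smul : Continuous fun p : mpPerm P × SubSigmaField P => p.1 • p.2 :=
  SubSigmaField.isInducing_infDist.continuous_iff.2 (continuous_pi continuous_infDist_smul)

instance : ContinuousSMul (Aut P) (SubSigmaField P) where
  continuous_smul :=
    (QuotientGroup.isOpenQuotientMap_mk.prodMap .id).isQuotientMap.continuous_iff.2
      continuous_mpPerm_smul

variable [StandardBorelSpace Ω]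

instance : ContinuousSMul (Aut P) (CondNonatomicField P) where
  continuous_smul :=
    (continuous_fst.smul (continuous_subtype_val.comp continuous_snd)).subtype_mk _

lemma continuousSMul_filtrationSpace {T : Set ℝ≥0∞} (hT : IsCompact T) :
    ContinuousSMul (Aut P) (FiltrationSpace P T) where
  continuous_smul := by
    have : CompactSpace T := isCompact_iff_compactSpace.1 hT
    exact (continuous_fst.smul (continuous_subtype_val.comp continuous_snd)).subtype_mk _

end Action

theorem isPolishGSpace_filtrationSpace {Ω : Type*} [MeasurableSpace Ω] [StandardBorelSpace Ω]
    {P : Measure Ω} [IsProbabilityMeasure P] [NullSingletonClass P] {T : Set ℝ≥0∞}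
    (hT : IsCompact T) : IsPolishGSpace (Aut P) (FiltrationSpace P T) where
  isTopologicalGroup := inferInstance
  polishGroup := inferInstance
  polishSpace := polishSpace_filtrationSpace hT
  continuousSMul := continuousSMul_filtrationSpace hT

/-! ### Products of functions of two independent variables -/

section Tensor

variable {Ω Ω₁ Ω₂ : Type*} [MeasurableSpace Ω] [MeasurableSpace Ω₁] [MeasurableSpace Ω₂]
  {P : Measure Ω} {P₁ : Measure Ω₁} {P₂ : Measure Ω₂} {p : Ω → Ω₁} {q : Ω → Ω₂}

lemma memLp_mul_comp (hp : MeasurePreserving p P P₁) (hq : MeasurePreserving q P P₂)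
    (hpq : IndepFun p q P) (f : Lp ℝ 2 P₁) (g : Lp ℝ 2 P₂) :
    MemLp (fun ω => f (p ω) * g (q ω)) 2 P := by
  have hf : Measurable f := (Lp.stronglyMeasurable f).measurable
  have hg : Measurable g := (Lp.stronglyMeasurable g).measurable
  refine (memLp_two_iff_integrable_sq
    ((hf.comp hp.measurable).mul (hg.comp hq.measurable)).aestronglyMeasurable).2 ?_
  have hind : IndepFun (fun ω => f (p ω) ^ 2) (fun ω => g (q ω) ^ 2) P :=
    hpq.comp (hf.pow_const 2) (hg.pow_const 2)
  exact (hind.integrable_mul (hp.integrable_comp_of_integrable (Lp.memLp f).integrable_sq)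
    (hq.integrable_comp_of_integrable (Lp.memLp g).integrable_sq)).congr
    (.of_forall fun ω => (mul_pow _ _ _).symm)

/-- The product `f ∘ p * g ∘ q` of square integrable functions of two independent variables `p` and
`q`. Independence is an argument of the definition, since it makes the product square integrable. -/
noncomputable def tensor (hp : MeasurePreserving p P P₁) (hq : MeasurePreserving q P P₂)
    (hpq : IndepFun p q P) (f : Lp ℝ 2 P₁) (g : Lp ℝ 2 P₂) : Lp ℝ 2 P :=
  (memLp_mul_comp hp hq hpq f g).toLp

variable (hp : MeasurePreserving p P P₁) (hq : MeasurePreserving q P P₂) (hpq : IndepFun p q P)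

lemma coeFn_tensor (f : Lp ℝ 2 P₁) (g : Lp ℝ 2 P₂) :
    tensor hp hq hpq f g =ᵐ[P] fun ω => f (p ω) * g (q ω) :=
  MemLp.coeFn_toLp _

lemma tensor_sub_left (f f' : Lp ℝ 2 P₁) (g : Lp ℝ 2 P₂) :
    tensor hp hq hpq (f - f') g = tensor hp hq hpq f g - tensor hp hq hpq f' g := by
  ext1
  grw [Lp.coeFn_sub, coeFn_tensor, coeFn_tensor, coeFn_tensor]
  filter_upwards [hp.quasiMeasurePreserving.ae (Lp.coeFn_sub f f')] with ω hω
  simp only [hω, Pi.sub_apply, sub_mul]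

lemma tensor_sub_right (f : Lp ℝ 2 P₁) (g g' : Lp ℝ 2 P₂) :
    tensor hp hq hpq f (g - g') = tensor hp hq hpq f g - tensor hp hq hpq f g' := by
  ext1
  grw [Lp.coeFn_sub, coeFn_tensor, coeFn_tensor, coeFn_tensor]
  filter_upwards [hq.quasiMeasurePreserving.ae (Lp.coeFn_sub g g')] with ω hω
  simp only [hω, Pi.sub_apply, mul_sub]

lemma inner_tensor (f f' : Lp ℝ 2 P₁) (g g' : Lp ℝ 2 P₂) :
    inner ℝ (tensor hp hq hpq f g) (tensor hp hq hpq f' g') = inner ℝ f f' * inner ℝ g g' := by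
  have hf : AEStronglyMeasurable (fun x => f' x * f x) (P.map p) :=
    ((Lp.stronglyMeasurable f').mul (Lp.stronglyMeasurable f)).aestronglyMeasurable
  have hg : AEStronglyMeasurable (fun y => g' y * g y) (P.map q) :=
    ((Lp.stronglyMeasurable g').mul (Lp.stronglyMeasurable g)).aestronglyMeasurable
  have hfactor := hpq.integral_fun_comp_mul_comp hp.aemeasurable hq.aemeasurable hf hg
  rw [← integral_map hp.aemeasurable hf, ← integral_map hq.aemeasurable hg, hp.map_eq,
    hq.map_eq] at hfactor
  simp only [L2.inner_def]
  refine Eq.trans (integral_congr_ae ?_) hfactor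
  filter_upwards [coeFn_tensor hp hq hpq f g, coeFn_tensor hp hq hpq f' g'] with ω hω hω'
  rw [hω, hω']
  exact mul_mul_mul_comm _ _ _ _

lemma norm_tensor (f : Lp ℝ 2 P₁) (g : Lp ℝ 2 P₂) : ‖tensor hp hq hpq f g‖ = ‖f‖ * ‖g‖ := by
  have h := inner_tensor hp hq hpq f f g g
  simp only [real_inner_self_eq_norm_sq, ← mul_pow] at h
  exact (sq_eq_sq₀ (norm_nonneg _) (by positivity)).1 h

lemma tendsto_tensor {ι : Type*} {l : Filter ι} {u : ι → Lp ℝ 2 P₁} {v : ι → Lp ℝ 2 P₂}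
    {f : Lp ℝ 2 P₁} {g : Lp ℝ 2 P₂} (hu : Tendsto u l (𝓝 f)) (hv : Tendsto v l (𝓝 g)) :
    Tendsto (fun i => tensor hp hq hpq (u i) (v i)) l (𝓝 (tensor hp hq hpq f g)) := by
  have hlim : Tendsto (fun i => ‖u i - f‖ * ‖v i‖ + ‖f‖ * ‖v i - g‖) l (𝓝 (0 * ‖g‖ + ‖f‖ * 0)) :=
    ((tendsto_iff_norm_sub_tendsto_zero.1 hu).mul hv.norm).add
      (tendsto_const_nhds.mul (tendsto_iff_norm_sub_tendsto_zero.1 hv))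
  rw [zero_mul, mul_zero, add_zero] at hlim
  refine tendsto_iff_norm_sub_tendsto_zero.2
    (squeeze_zero (fun _ => norm_nonneg _) (fun i => ?_) hlim)
  calc ‖tensor hp hq hpq (u i) (v i) - tensor hp hq hpq f g‖
      = ‖tensor hp hq hpq (u i - f) (v i) + tensor hp hq hpq f (v i - g)‖ := by
        rw [tensor_sub_left, tensor_sub_right, sub_add_sub_cancel]
    _ ≤ ‖u i - f‖ * ‖v i‖ + ‖f‖ * ‖v i - g‖ := by
        rw [← norm_tensor hp hq hpq, ← norm_tensor hp hq hpq]
        exact norm_add_le _ _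

variable [IsFiniteMeasure P] [IsFiniteMeasure P₁] [IsFiniteMeasure P₂]

lemma tensor_indicatorLp_indicatorLp {A : Set Ω₁} {B : Set Ω₂} (hA : MeasurableSet A)
    (hB : MeasurableSet B) : tensor hp hq hpq (indicatorLp P₁ hA) (indicatorLp P₂ hB) =
      indicatorLp P ((hp.measurable hA).inter (hq.measurable hB)) := by
  ext1
  grw [coeFn_tensor, coeFn_indicatorLp]
  filter_upwards [hp.quasiMeasurePreserving.ae (coeFn_indicatorLp (P := P₁) (p := 2) hA),
    hq.quasiMeasurePreserving.ae (coeFn_indicatorLp (P := P₂) (p := 2) hB)] with ω hωA hωB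
  rw [hωA, hωB]
  by_cases hA : p ω ∈ A <;> by_cases hB : q ω ∈ B <;> simp [hA, hB]

omit [IsFiniteMeasure P] [IsFiniteMeasure P₁] in
lemma tensor_indicatorLp_univ (f : Lp ℝ 2 P₁) :
    tensor hp hq hpq f (indicatorLp P₂ MeasurableSet.univ) = koopman hp f := by
  ext1
  grw [coeFn_tensor, coeFn_koopman]
  filter_upwards [hq.quasiMeasurePreserving.ae (coeFn_indicatorLp_univ (P := P₂) (p := 2))]
    with ω hω
  simp only [hω, mul_one, Function.comp_apply]

omit [IsFiniteMeasure P] [IsFiniteMeasure P₂] in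
lemma indicatorLp_univ_tensor (g : Lp ℝ 2 P₂) :
    tensor hp hq hpq (indicatorLp P₁ MeasurableSet.univ) g = koopman hq g := by
  ext1
  grw [coeFn_tensor, coeFn_koopman]
  filter_upwards [hp.quasiMeasurePreserving.ae (coeFn_indicatorLp_univ (P := P₁) (p := 2))]
    with ω hω
  simp only [hω, one_mul, Function.comp_apply]

end Tensor

/-! ### Joins of independent sub-σ-fields -/

section Join

lemma comap_sup_comap_eq_generateFrom {α β γ : Type*} {m₁ : MeasurableSpace β}
    {m₂ : MeasurableSpace γ} (p : α → β) (q : α → γ) :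
    m₁.comap p ⊔ m₂.comap q = MeasurableSpace.generateFrom (preimage (fun x => (p x, q x)) ''
      image2 (· ×ˢ ·) {s | MeasurableSet s} {t | MeasurableSet t}) := by
  rw [← MeasurableSpace.comap_generateFrom, generateFrom_prod]
  exact (MeasurableSpace.comap_prodMk p q).symm

variable {Ω Ω₁ Ω₂ : Type*} [mΩ : MeasurableSpace Ω] [m₁ : MeasurableSpace Ω₁]
  [m₂ : MeasurableSpace Ω₂] {P : Measure Ω} {P₁ : Measure Ω₁} {P₂ : Measure Ω₂}
  {p : Ω → Ω₁} {q : Ω → Ω₂} {F F' : SubSigmaField P₁} {E E' : SubSigmaField P₂}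

variable (P p q F E) in
/-- The sub-σ-field generated by the preimages of `F` under `p`, the preimages of `E` under `q`, and
the null sets. -/
def join : SubSigmaField P :=
  .completion (F.toMeasurableSpace.comap p ⊔ E.toMeasurableSpace.comap q) P

lemma join_mono (hF : F.toMeasurableSpace ≤ F'.toMeasurableSpace)
    (hE : E.toMeasurableSpace ≤ E'.toMeasurableSpace) :
    (join P p q F E).toMeasurableSpace ≤ (join P p q F' E').toMeasurableSpace :=
  SubSigmaField.completion_mono
    (sup_le_sup (MeasurableSpace.comap_mono hF) (MeasurableSpace.comap_mono hE))

lemma isTrivial_join [IsProbabilityMeasure P] (hp : MeasurePreserving p P P₁)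
    (hq : MeasurePreserving q P P₂) (hF : F.IsTrivial) (hE : E.IsTrivial) :
    (join P p q F E).IsTrivial := by
  refine SubSigmaField.isTrivial_iff.2 (SubSigmaField.completion_le (sup_le ?_ ?_))
  · rintro _ ⟨A, hA, rfl⟩
    rw [SubSigmaField.measurableSet_completion_bot (hp.measurable (F.le A hA)),
      hp.measure_preimage (F.le A hA).nullMeasurableSet]
    exact hF A hA
  · rintro _ ⟨B, hB, rfl⟩
    rw [SubSigmaField.measurableSet_completion_bot (hq.measurable (E.le B hB)),
      hq.measure_preimage (E.le B hB).nullMeasurableSet]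
    exact hE B hB

variable (hp : MeasurePreserving p P P₁) (hq : MeasurePreserving q P P₂)

include hp hq in
lemma comap_sup_comap_le : F.toMeasurableSpace.comap p ⊔ E.toMeasurableSpace.comap q ≤ mΩ :=
  sup_le ((MeasurableSpace.comap_mono F.le).trans hp.measurable.comap_le)
    ((MeasurableSpace.comap_mono E.le).trans hq.measurable.comap_le)

variable [IsFiniteMeasure P]

lemma tensor_mem_join_space (hpq : IndepFun p q P) {f : Lp ℝ 2 P₁} {g : Lp ℝ 2 P₂}
    (hf : f ∈ F.space) (hg : g ∈ E.space) :
    tensor hp hq hpq f g ∈ (join P p q F E).space := by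
  rw [join, SubSigmaField.space_completion (comap_sup_comap_le hp hq)]
  obtain ⟨f', hf', hff'⟩ := hf
  obtain ⟨g', hg', hgg'⟩ := hg
  have hfp : StronglyMeasurable[F.toMeasurableSpace.comap p ⊔ E.toMeasurableSpace.comap q]
      (f' ∘ p) := hf'.comp_measurable fun A hA => le_sup_left (a := F.toMeasurableSpace.comap p)
        (b := E.toMeasurableSpace.comap q) _ ⟨A, hA, rfl⟩
  have hgq : StronglyMeasurable[F.toMeasurableSpace.comap p ⊔ E.toMeasurableSpace.comap q]
      (g' ∘ q) := hg'.comp_measurable fun B hB => le_sup_right (a := F.toMeasurableSpace.comap p)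
        (b := E.toMeasurableSpace.comap q) _ ⟨B, hB, rfl⟩
  refine ⟨_, hfp.mul hgq, ?_⟩
  filter_upwards [coeFn_tensor hp hq hpq f g, hp.quasiMeasurePreserving.ae hff',
    hq.quasiMeasurePreserving.ae hgg'] with ω hω hfω hgω
  rw [hω, hfω, hgω]
  rfl

variable [IsFiniteMeasure P₁] [IsFiniteMeasure P₂]

lemma join_space_le (hpq : IndepFun p q P) {K : Submodule ℝ (Lp ℝ 2 P)}
    (hK : IsClosed (K : Set (Lp ℝ 2 P)))
    (h : ∀ f ∈ F.space, ∀ g ∈ E.space, tensor hp hq hpq f g ∈ K) :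
    (join P p q F E).space ≤ K := by
  rw [join, SubSigmaField.space_completion (comap_sup_comap_le hp hq)]
  refine lpMeas_le_of_generateFrom (by simp) hK (comap_sup_comap_le hp hq)
    (comap_sup_comap_eq_generateFrom p q)
    ((@isPiSystem_prod _ _ F.toMeasurableSpace E.toMeasurableSpace).comap _) ?_ ?_
  · have huniv := h _ F.indicatorLp_univ_mem_space _ E.indicatorLp_univ_mem_space
    rwa [tensor_indicatorLp_univ] at huniv
  · rintro _ ⟨_, ⟨A, hA, B, hB, rfl⟩, rfl⟩ _
    have hAB := h _ ((SubSigmaField.indicatorLp_mem_space (F.le A hA)).2 hA) _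
      ((SubSigmaField.indicatorLp_mem_space (E.le B hB)).2 hB)
    rwa [tensor_indicatorLp_indicatorLp] at hAB

lemma eq_top_of_tensor_mem (hpq : IndepFun p q P) (hgen : m₁.comap p ⊔ m₂.comap q = mΩ)
    {K : Submodule ℝ (Lp ℝ 2 P)} (hK : IsClosed (K : Set (Lp ℝ 2 P)))
    (h : ∀ f g, tensor hp hq hpq f g ∈ K) : K = ⊤ := by
  refine eq_top_of_generateFrom (by simp) hK
    (hgen.symm.trans (comap_sup_comap_eq_generateFrom p q)) (isPiSystem_prod.comap _) ?_ ?_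
  · have huniv := h (indicatorLp P₁ MeasurableSet.univ) (indicatorLp P₂ MeasurableSet.univ)
    rwa [tensor_indicatorLp_univ] at huniv
  · rintro _ ⟨_, ⟨A, hA, B, hB, rfl⟩, rfl⟩ _
    have hAB := h (indicatorLp P₁ hA) (indicatorLp P₂ hB)
    rwa [tensor_indicatorLp_indicatorLp] at hAB

theorem proj_join_tensor (hpq : IndepFun p q P) (f : Lp ℝ 2 P₁) (g : Lp ℝ 2 P₂) :
    (join P p q F E).proj (tensor hp hq hpq f g) = tensor hp hq hpq (F.proj f) (E.proj g) := by
  refine Submodule.eq_starProjection_of_mem_orthogonal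
    (tensor_mem_join_space hp hq hpq (F.proj_mem f) (E.proj_mem g)) ?_
  rw [← Submodule.span_singleton_le_iff_mem, Submodule.le_orthogonal_iff_le_orthogonal]
  refine join_space_le hp hq hpq (Submodule.isClosed_orthogonal _) fun f' hf' g' hg' => ?_
  rw [Submodule.mem_orthogonal_singleton_iff_inner_right, inner_sub_left, inner_tensor,
    inner_tensor, Submodule.inner_starProjection_left_eq_right,
    Submodule.inner_starProjection_left_eq_right, SubSigmaField.proj_eq_self.2 hf',
    SubSigmaField.proj_eq_self.2 hg', sub_self]

include hq in
lemma proj_join_koopman_left (hpq : IndepFun p q P) (f : Lp ℝ 2 P₁) :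
    (join P p q F E).proj (koopman hp f) = koopman hp (F.proj f) := by
  rw [← tensor_indicatorLp_univ hp hq hpq, proj_join_tensor,
    SubSigmaField.proj_eq_self.2 E.indicatorLp_univ_mem_space, tensor_indicatorLp_univ]

include hp in
lemma proj_join_koopman_right (hpq : IndepFun p q P) (g : Lp ℝ 2 P₂) :
    (join P p q F E).proj (koopman hq g) = koopman hq (E.proj g) := by
  rw [← indicatorLp_univ_tensor hp hq hpq, proj_join_tensor,
    SubSigmaField.proj_eq_self.2 F.indicatorLp_univ_mem_space, indicatorLp_univ_tensor]

include hq in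
lemma infDist_join_koopman_left (hpq : IndepFun p q P) (f : Lp ℝ 2 P₁) :
    (join P p q F E).infDist (koopman hp f) = F.infDist f := by
  rw [SubSigmaField.infDist_eq_norm_sub_proj, proj_join_koopman_left hp hq hpq, ← map_sub,
    LinearIsometry.norm_map, SubSigmaField.infDist_eq_norm_sub_proj]

include hp in
lemma infDist_join_koopman_right (hpq : IndepFun p q P) (g : Lp ℝ 2 P₂) :
    (join P p q F E).infDist (koopman hq g) = E.infDist g := by
  rw [SubSigmaField.infDist_eq_norm_sub_proj, proj_join_koopman_right hp hq hpq, ← map_sub,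
    LinearIsometry.norm_map, SubSigmaField.infDist_eq_norm_sub_proj]

include hp hq in
lemma isCondNonatomic_join [StandardBorelSpace Ω] [StandardBorelSpace Ω₁]
    (hpq : IndepFun p q P) (hF : F.IsCondNonatomic) : (join P p q F E).IsCondNonatomic := by
  refine SubSigmaField.isCondNonatomic_of_tendsto hF.tendsto_meanSumSq_label fun n =>
    (SubSigmaField.integral_sumSqAtoms_condExpKernel_le_meanSumSq
      ((measurable_label n).comp hp.measurable) _).trans_eq (Finset.sum_congr rfl fun k _ => ?_)
  have hproj := proj_join_koopman_left (F := F) (E := E) hp hq hpq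
    (indicatorLp P₁ (measurable_label n (measurableSet_singleton k)))
  rw [← (koopman hp).norm_map, ← hproj]
  rfl

include hp hq in
lemma continuous_proj_join {S : Type*} [TopologicalSpace S] {F : S → SubSigmaField P₁}
    {E : S → SubSigmaField P₂} (hF : Continuous F) (hE : Continuous E) (hpq : IndepFun p q P)
    (hgen : m₁.comap p ⊔ m₂.comap q = mΩ) (h : Lp ℝ 2 P) :
    Continuous fun s => (join P p q (F s) (E s)).proj h := by
  refine continuous_iff_continuousAt.2 fun s => ?_
  let G (t : S) := join P p q (F t) (E t)
  let K := tendstoSubmodule (fun t => (G t).proj.toLinearMap) (𝓝 s) (G s).proj.toLinearMap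
  have hK : K = ⊤ := by
    refine eq_top_of_tensor_mem hp hq hpq hgen
      (isClosed_setOf_tendsto (fun t => (G t).lipschitzWith_proj) (G s).lipschitzWith_proj)
      fun f g => ?_
    change Tendsto (fun t => (G t).proj (tensor hp hq hpq f g)) (𝓝 s)
      (𝓝 ((G s).proj (tensor hp hq hpq f g)))
    simp only [G, proj_join_tensor]
    exact tendsto_tensor hp hq hpq (((SubSigmaField.continuous_proj f).comp hF).tendsto s)
      (((SubSigmaField.continuous_proj g).comp hE).tendsto s)
  exact hK.ge (Submodule.mem_top (x := h))

include hp hq in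
theorem continuous_join {S : Type*} [TopologicalSpace S] {F : S → SubSigmaField P₁}
    {E : S → SubSigmaField P₂} (hF : Continuous F) (hE : Continuous E) (hpq : IndepFun p q P)
    (hgen : m₁.comap p ⊔ m₂.comap q = mΩ) : Continuous fun s => join P p q (F s) (E s) :=
  (SubSigmaField.isInducing_proj denseRange_id).continuous_iff.2
    (continuous_pi (continuous_proj_join hp hq hF hE hpq hgen))

end Join

/-! ### Independent copies and approximation by automorphisms -/

section Copies

variable {Ω Ω' : Type*} [mΩ : MeasurableSpace Ω] [m' : MeasurableSpace Ω'] [StandardBorelSpace Ω']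
  {P : Measure Ω} {P' : Measure Ω'} [IsProbabilityMeasure P] [IsProbabilityMeasure P']

theorem exists_indepFun_comap_sup_comap_eq {Ω₁ Ω₂ : Type*} [StandardBorelSpace Ω]
    [m₁ : MeasurableSpace Ω₁] [m₂ : MeasurableSpace Ω₂] [StandardBorelSpace Ω₁]
    [StandardBorelSpace Ω₂] (P : Measure Ω) [IsProbabilityMeasure P] [NullSingletonClass P]
    (P₁ : Measure Ω₁) (P₂ : Measure Ω₂) [IsProbabilityMeasure P₁] [IsProbabilityMeasure P₂]
    [NullSingletonClass P₁] : ∃ (p : Ω → Ω₁) (q : Ω → Ω₂), MeasurePreserving p P P₁ ∧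
      MeasurePreserving q P P₂ ∧ IndepFun p q P ∧ m₁.comap p ⊔ m₂.comap q = mΩ := by
  obtain ⟨e, he, -⟩ := exists_measurableEquiv_labelled (P := P) (P' := P₁.prod P₂)
    (κ := fun _ => 0) (κ' := fun _ => 0) measurable_const measurable_const (by simp)
  have hp : MeasurePreserving (Prod.fst ∘ e) P P₁ := measurePreserving_fst.comp he
  have hq : MeasurePreserving (Prod.snd ∘ e) P P₂ := measurePreserving_snd.comp he
  refine ⟨Prod.fst ∘ e, Prod.snd ∘ e, hp, hq, ?_, ?_⟩
  · rw [indepFun_iff_map_prod_eq_prod_map_map hp.aemeasurable hq.aemeasurable, hp.map_eq, hq.map_eq]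
    exact he.map_eq
  · rw [← MeasurableSpace.comap_comp, ← MeasurableSpace.comap_comp, ← MeasurableSpace.comap_sup]
    exact e.measurableEmbedding.comap_eq

lemma norm_koopman_coordLp_sub_le {S T : Ω → Ω'} (hS : MeasurePreserving S P P')
    (hT : MeasurePreserving T P P') {n : ℕ} (hn : 0 < n)
    (h : ∀ᵐ ω ∂P, label n (S ω) = label n (T ω)) :
    ‖koopman hS (coordLp P') - koopman hT (coordLp P')‖ ≤ 1 / n := by
  have hbound : ∀ᵐ ω ∂P, ‖(koopman hS (coordLp P') - koopman hT (coordLp P') : Lp ℝ 2 P) ω‖ ≤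
      1 / (n : ℝ) := by
    filter_upwards [Lp.coeFn_sub (koopman hS (coordLp P')) (koopman hT (coordLp P')),
      coeFn_koopman hS (coordLp P'), coeFn_koopman hT (coordLp P'), h,
      hS.quasiMeasurePreserving.ae (coeFn_coordLp P'),
      hT.quasiMeasurePreserving.ae (coeFn_coordLp P')] with ω hsub hSω hTω hlabel hcS hcT
    rw [hsub, Pi.sub_apply, hSω, hTω, Function.comp_apply, Function.comp_apply, hcS, hcT,
      Real.norm_eq_abs, le_div_iff₀' (by exact_mod_cast hn)]
    exact (mul_abs_coord_sub_lt_one hlabel).le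
  simpa [measureUnivNNReal] using Lp.norm_le_of_ae_bound (by positivity) hbound

theorem exists_measurableEquiv_tendsto_koopman [StandardBorelSpace Ω] [NullSingletonClass P]
    [NullSingletonClass P'] {p : Ω → Ω'} (hp : MeasurePreserving p P P') :
    ∃ (e : ℕ → Ω ≃ᵐ Ω') (he : ∀ n, MeasurePreserving (e n) P P'),
      ∀ f, Tendsto (fun n => koopman (he n) f) atTop (𝓝 (koopman hp f)) := by
  have hlabel (n : ℕ) : Measurable fun ω : Ω' => (label n ω : ℕ) :=
    measurable_from_top.comp (measurable_label n)
  have hex (n : ℕ) : ∃ e : Ω ≃ᵐ Ω', MeasurePreserving e P P' ∧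
      ∀ᵐ ω ∂P, (label n (e ω) : ℕ) = label n (p ω) :=
    exists_measurableEquiv_labelled ((hlabel n).comp hp.measurable) (hlabel n)
      (by rw [← Measure.map_map (hlabel n) hp.measurable, hp.map_eq])
  choose e he heq using hex
  refine ⟨e, he, tendsto_koopman_of_coordLp (tendsto_iff_norm_sub_tendsto_zero.2 ?_)⟩
  refine squeeze_zero' (.of_forall fun _ => norm_nonneg _) ?_
    (tendsto_one_div_atTop_nhds_zero_nat (𝕜 := ℝ))
  filter_upwards [eventually_gt_atTop 0] with n hn
  exact norm_koopman_coordLp_sub_le (he n) hp hn ((heq n).mono fun ω h => Fin.ext h)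

end Copies

/-! ### Joins of filtrations and closures of orbits -/

section FiltrationConvergence

variable {Ω : Type*} [mΩ : MeasurableSpace Ω] [StandardBorelSpace Ω] {P : Measure Ω}
  [IsFiniteMeasure P] {T : Set ℝ≥0∞}

lemma tendsto_filtrationSpace [CompactSpace T] {ι : Type*} {l : Filter ι}
    {u : ι → FiltrationSpace P T} {x : FiltrationSpace P T}
    (h : ∀ f, TendstoUniformly (fun i t => ((u i).1 t).1.infDist f)
      (fun t => (x.1 t).1.infDist f) l) : Tendsto u l (𝓝 x) := by
  let D : C(CondNonatomicField P, Lp ℝ 2 P → ℝ) :=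
    ⟨fun E => E.1.infDist, continuous_pi fun f =>
      (SubSigmaField.continuous_infDist f).comp continuous_subtype_val⟩
  have hD : IsInducing D := SubSigmaField.isInducing_infDist.comp .subtypeVal
  have hval : IsInducing (Subtype.val : FiltrationSpace P T → C(T, CondNonatomicField P)) :=
    .subtypeVal
  refine ((D.isInducing_postcomp hD).comp hval).tendsto_nhds_iff.2 ?_
  rw [ContinuousMap.tendsto_iff_tendstoUniformly, tendstoUniformly_iff_tendsto, Pi.uniformity,
    tendsto_iInf]
  exact fun f => tendsto_comap_iff.2 (tendstoUniformly_iff_tendsto.1 (h f))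

end FiltrationConvergence

section JoinFiltration

variable {Ω : Type*} [mΩ : MeasurableSpace Ω] [StandardBorelSpace Ω] {P : Measure Ω}
  [IsProbabilityMeasure P] {T : Set ℝ≥0∞}

/-- The filtration `t ↦ join P p q (x t) (y t)` in which the filtration `x`, pulled back along `p`,
and `y`, pulled back along `q`, evolve independently. The independence of `p` and `q` makes the join
conditionally nonatomic; that they generate the σ-field of `Ω` makes it continuous in `t`. -/
noncomputable def joinFiltration {p q : Ω → Ω} (hp : MeasurePreserving p P P)
    (hq : MeasurePreserving q P P) (hpq : IndepFun p q P) (hgen : mΩ.comap p ⊔ mΩ.comap q = mΩ)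
    (x y : FiltrationSpace P T) : FiltrationSpace P T :=
  ⟨⟨fun t => ⟨join P p q (x.1 t).1 (y.1 t).1, isCondNonatomic_join hp hq hpq (x.1 t).2⟩,
    (continuous_join hp hq (continuous_subtype_val.comp x.1.continuous)
      (continuous_subtype_val.comp y.1.continuous) hpq hgen).subtype_mk _⟩,
    fun s t hst => join_mono (x.2.mono s t hst) (y.2.mono s t hst),
    fun t ht => isTrivial_join hp hq (x.2.trivial_of_least t ht) (y.2.trivial_of_least t ht)⟩

variable [NullSingletonClass P] [CompactSpace T]

lemma mem_closure_orbit_of_infDist_koopman_eq {x z : FiltrationSpace P T} {p : Ω → Ω}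
    (hp : MeasurePreserving p P P)
    (h : ∀ t f, (z.1 t).1.infDist (koopman hp f) = (x.1 t).1.infDist f) :
    x ∈ closure (MulAction.orbit (Aut P) z) := by
  obtain ⟨e, he, hlim⟩ := exists_measurableEquiv_tendsto_koopman hp
  let g (n : ℕ) : mpPerm P := ⟨(e n).toEquiv, he n, (he n).symm (e n)⟩
  refine mem_closure_of_tendsto (f := fun n => (QuotientGroup.mk (g n) : Aut P) • z) (b := atTop)
    (tendsto_filtrationSpace fun f => Metric.tendstoUniformly_iff.2 fun ε hε => ?_)
    (.of_forall fun n => ⟨_, rfl⟩)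
  filter_upwards [Metric.tendsto_nhds.1 (hlim f) ε hε] with n hn t
  calc dist ((x.1 t).1.infDist f) ((g n • (z.1 t).1).infDist f)
      = dist ((z.1 t).1.infDist (koopman hp f)) ((z.1 t).1.infDist (koopmanPerm (g n) f)) := by
        rw [h, infDist_smul_field]
    _ ≤ dist (koopman hp f) (koopmanPerm (g n) f) := by
        simpa using (z.1 t).1.lipschitzWith_infDist.dist_le_mul _ _
    _ < ε := by rwa [dist_comm]

theorem exists_mem_closure_orbit (x y : FiltrationSpace P T) :
    ∃ z : FiltrationSpace P T, x ∈ closure (MulAction.orbit (Aut P) z) ∧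
      y ∈ closure (MulAction.orbit (Aut P) z) := by
  obtain ⟨p, q, hp, hq, hpq, hgen⟩ := exists_indepFun_comap_sup_comap_eq P P P
  exact ⟨joinFiltration hp hq hpq hgen x y,
    mem_closure_orbit_of_infDist_koopman_eq hp fun _ => infDist_join_koopman_left hp hq hpq,
    mem_closure_orbit_of_infDist_koopman_eq hq fun _ => infDist_join_koopman_right hp hq hpq⟩

end JoinFiltration

/-! ### Generic ergodicity -/

theorem isMeagre_or_mem_residual {G X : Type*} [Group G] [TopologicalSpace X] [BaireSpace X]
    [MulAction G X] [ContinuousConstSMul G X]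
    (h : ∀ x y : X, ∃ z, x ∈ closure (MulAction.orbit G z) ∧ y ∈ closure (MulAction.orbit G z))
    {A : Set X} (hA : ∀ g : G, ∀ x ∈ A, g • x ∈ A) (hb : BaireMeasurableSet A) :
    IsMeagre A ∨ A ∈ residual X := by
  obtain ⟨U, hU, hAU⟩ := hb.residualEq_isOpen
  obtain ⟨V, hV, hAV⟩ := hb.compl.residualEq_isOpen
  obtain rfl | ⟨x, hx⟩ := U.eq_empty_or_nonempty
  · refine .inl (hAU.mem_iff.mono fun a ha => ?_)
    exact fun haA => ha.1 haA
  obtain rfl | ⟨y, hy⟩ := V.eq_empty_or_nonempty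
  · exact .inr (hAV.mem_iff.mono fun a ha => not_not.1 ha.1)
  exfalso
  obtain ⟨z, hzx, hzy⟩ := h x y
  obtain ⟨_, hgU, g, rfl⟩ := mem_closure_iff.1 hzx U hU hx
  obtain ⟨_, hgV, g', rfl⟩ := mem_closure_iff.1 hzy V hV hy
  let k := g' * g⁻¹
  have hkz : k • g • z = g' • z := by rw [smul_smul, inv_mul_cancel_right]
  have hW : IsOpen (U ∩ (k • ·) ⁻¹' V) := hU.inter (hV.preimage (continuous_const_smul k))
  have hk : Tendsto (k • · : X → X) (residual X) (residual X) :=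
    (Homeomorph.smul k).residual_map_eq.le
  have hdense : Dense {a | (a ∈ A ↔ a ∈ U) ∧ (k • a ∈ Aᶜ ↔ k • a ∈ V)} :=
    dense_of_mem_residual (hAU.mem_iff.and (hk.eventually hAV.mem_iff))
  obtain ⟨a, ⟨haU, hkaV⟩, hmem, hkmem⟩ := hdense.inter_open_nonempty _ hW
    ⟨g • z, hgU, by rwa [mem_preimage, hkz]⟩
  exact hkmem.2 hkaV (hA k a (hmem.2 haU))

end ProbSpace

theorem mainTheorem1 {Ω : Type*} [MeasurableSpace Ω] [StandardBorelSpace Ω]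
    (P : Measure Ω) [IsProbabilityMeasure P] [NullSingletonClass P]
    (T : Set ℝ≥0∞) (hT : IsCompact T) :
    IsErgodicGSpace (ProbSpace.Aut P) (ProbSpace.FiltrationSpace P T) := by
  have hG := ProbSpace.isPolishGSpace_filtrationSpace (P := P) hT
  have := hG.polishSpace
  have := hG.continuousSMul
  have : CompactSpace T := isCompact_iff_compactSpace.1 hT
  exact ⟨hG, fun A hA hb =>
    ProbSpace.isMeagre_or_mem_residual ProbSpace.exists_mem_closure_orbit hA hb⟩
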